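/- **Setting.** Let $R\subset\mathbb R^n\subset V=\mathbb C^n$ be an irreducible reduced crystallographic root system of rank $n$ with Weyl group $W$, positive roots $R_+$, simple roots $\Delta=\{\alpha_1,\dots,\alpha_n\}$, maximal root $\theta$, coroot lattice $Q^\vee$, weight lattice $P$ and coweight lattice $P^\vee$. Let $\hbar\in\mathbb C\setminus\pi i\mathbb Q$. Write $[\alpha,c]$ for the affine functional $x\mapsto(\alpha,x)+c$ on $V$, put $\alpha_0=[-\theta,\hbar]$, and let $s_0,\dots,s_n$ be the affine reflections of $V$ in $\alpha_0,\dots,\alpha_n$. Let $\tau(\lambda)x=x+\hbar\lambda$, let $\widehat W=W\ltimes\tau(P^\vee)$, which acts on affine functionals by $(ga)(x)=a(g^{-1}x)$, and let $\Pi\subset\widehat W$ be the subgroup preserving $\{\alpha_0,\dots,\alpha_n\}$. Let $\widehat P=\{[\mu,\hbar k/\epsilon_0]: \mu\in P,\ k\in\mathbb Z\}$, where $\epsilon_0$ is a non-zero integer with $(P,P^\vee)\subset\epsilon_0^{-1}\mathbb Z$. Let $t$ be a $\widehat W$-invariant function from the affine root system $\widehat R=\{[\alpha,\hbar k]:\alpha\in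 R,\ k\in\mathbb Z\}$ to $\mathbb C\setminus\{0\}$, and $t_j=t_{\alpha_j}$. The double affine Hecke algebra $\mathbb H_t$ is the algebra with generators $T_0,\dots,T_n$, $X^\mu$ ($\mu\in\widehat P$) and the elements of the group $\Pi$, and with the following relations: $X^{\mu+\nu}=X^\mu X^\nu$; $X^{[0,c]}=e^{c}$; $(T_j-t_j)(T_j+t_j^{-1})=0$; $T_iT_jT_i\cdots=T_jT_iT_j\cdots$ for $i\neq j$, with $m_{ij}$ factors on each side, if the order $m_{ij}$ of $s_is_j$ is finite; $\pi T_i\pi^{-1}=T_j$ if $\pi\in\Pi$ and $\pi(\alpha_i)=\alpha_j$; $T_j^{-1}X^\mu T_j^{-1}=X^{\mu-\alpha_j}$ if $(\mu,\alpha_j^\vee)=1$; $T_jX^\mu=X^\mu T_j$ if $(\mu,\alpha_j^\vee)=0$; $\pi X^\mu\pi^{-1}=X^{\pi(\mu)}$. Let $\mathcal F$ be the algebra of entire (complex-smooth) functions on $V$ that are periodic with respect to $2\pi iQ^\vee$. In its polynomial representation on $\mathcal F$, which is faithful, $X^\mu$ acts as multiplication by $e^{\mu(x)}$, $\pi\in\Pi$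 acts by $(\pi f)(x)=f(\pi^{-1}x)$, and $$T_j=t_j+\frac{t_j^{-1}-t_je^{-\alpha_j(x)}}{1-e^{-\alpha_j(x)}}\,(s_j-1),\qquad j=0,\dots,n .$$ **Arrangement.** Let $\eta\colon R\to\mathbb C$ be $W$-invariant and let $S_0\subset\Delta$. Let $R_0$ be the root system of all roots in the linear span of $S_0$, let $R_1,\dots,R_m$ be its irreducible components, $S_\ell=S_0\cap R_\ell$ and $k_\ell=|S_\ell|$. Let $\theta_\ell=\sum_{\alpha\in S_\ell}n_\alpha\alpha$ be the maximal root of $R_\ell$ with respect to $S_\ell$, and let $h^\ell_\eta=\eta_{\theta_\ell}+\sum_{\alpha\in S_\ell}n_\alpha\eta_\alpha$. Let $r_1,\dots,r_m\in\mathbb Z_{\ge0}$ be such that $r_\ell=r_{\ell'}$ whenever $R_\ell\cong R_{\ell'}$. For $w\in W$ let $\Xi_{\vec r}(w)$ be the set of functions $\xi\colon wS_0\to\mathbb Z_{\ge0}$ such that $\xi(\alpha)=0$ implies $\alpha\in R_+$, and $\sum_{\alpha\in wS_\ell}\xi(\alpha)\le r_\ell$ for all $\ell$. Put $$H_\eta(wS_0;\xi)=\{x\in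 V:(\alpha,x)=\eta_\alpha-\hbar\,\xi(\alpha)\ \ \forall\alpha\in wS_0\},\qquad \mathcal D_{\vec r}=\bigcup_{w\in W}\ \bigcup_{\xi\in\Xi_{\vec r}(w)}H_\eta(wS_0;\xi).$$ **Theorem.** Suppose that $t_\alpha^2=e^{\eta_\alpha}$ for all $\alpha\in R$ and that, for all $\ell=1,\dots,m$: $\gcd(r_\ell+1,k_\ell+1)=1$ if $R_\ell\cong A_{k_\ell}$; $r_\ell=0$ if $R_\ell\not\cong A_{k_\ell}$; and $h^\ell_\eta=(r_\ell+1)\hbar$. Then the ideal $I_{\mathcal D_{\vec r}}=\{f\in\mathcal F: f(x)=0\ \text{for all}\ x\in\mathcal D_{\vec r}\}$ is invariant under the action of $\mathbb H_t$; that is, it is preserved by the algebra of operators on $\mathcal F$ generated by all $T_j$, $X^\mu$ and $\pi\in\Pi$. -/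

import Mathlib

open scoped ContDiff

universe u

noncomputable section

namespace DahaIdeals

/-! ### Two analytic helper facts

They are needed to see that the Demazure–Lusztig operators preserve the space of entire functions. -/

theorem contDiff_param_integral {E : Type u} [NormedAddCommGroup E] [NormedSpace ℂ E]
    [FiniteDimensional ℂ E] (n : ℕ) :
    ∀ {G : Type u} [NormedAddCommGroup G] [NormedSpace ℂ G] [CompleteSpace G]
      (Φ : E × ℂ → G), ContDiff ℂ ∞ Φ →
      ContDiff ℂ n (fun x => ∫ τ in (0 : ℝ)..1, Φ (x, (τ : ℂ))) := by
  induction n with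
  | zero =>
    intro G _ _ _ Φ hΦ
    rw [Nat.cast_zero, contDiff_zero]
    apply intervalIntegral.continuous_parametric_intervalIntegral_of_continuous'
    have := hΦ.continuous
    fun_prop
  | succ n ih =>
    intro G _ _ _ Φ hΦ
    have hc := hΦ.continuous
    have hD : ContDiff ℂ ∞ (fun p : E × ℂ => (fderiv ℂ Φ p).comp (ContinuousLinearMap.inl ℂ E ℂ)) :=
      (hΦ.fderiv_right (m := ∞) (by simp)).clm_comp contDiff_const
    have hDc := hD.continuous
    have key : ∀ x (τ : ℝ), HasFDerivAt (fun y : E => Φ (y, (τ : ℂ)))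
        ((fderiv ℂ Φ (x, (τ : ℂ))).comp (ContinuousLinearMap.inl ℂ E ℂ)) x := by
      intro x τ
      have h1 := (hΦ.differentiable (by simp) (x, (τ : ℂ))).hasFDerivAt
      exact h1.comp x (hasFDerivAt_prodMk_left (𝕜 := ℂ) x (τ : ℂ))
    push_cast
    rw [contDiff_succ_iff_hasFDerivAt]
    refine ⟨_, ih (fun p : E × ℂ => (fderiv ℂ Φ p).comp (ContinuousLinearMap.inl ℂ E ℂ)) hD,
      fun x => ?_⟩
    have : ProperSpace E := FiniteDimensional.proper ℂ E
    obtain ⟨C, hC⟩ := ((isCompact_closedBall x 1).prod (isCompact_Icc (a := (0 : ℝ)) (b := 1))).exists_bound_of_continuousOn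
      (f := fun p : E × ℝ => (fderiv ℂ Φ (p.1, (p.2 : ℂ))).comp (ContinuousLinearMap.inl ℂ E ℂ))
      (by
        have : Continuous (fun p : E × ℝ => (p.1, (p.2 : ℂ))) := by fun_prop
        exact (hDc.comp this).continuousOn)
    refine intervalIntegral.hasFDerivAt_integral_of_dominated_of_fderiv_le (𝕜 := ℂ)
      (F := fun (y : E) (τ : ℝ) => Φ (y, (τ : ℂ)))
      (F' := fun (y : E) (τ : ℝ) =>
        (fderiv ℂ Φ (y, (τ : ℂ))).comp (ContinuousLinearMap.inl ℂ E ℂ))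
      (bound := fun _ => C) (Metric.ball_mem_nhds x one_pos) ?_ ?_ ?_ ?_ ?_ ?_
    · refine Filter.Eventually.of_forall fun y => ?_
      exact Continuous.aestronglyMeasurable (by fun_prop)
    · exact Continuous.intervalIntegrable (by fun_prop) _ _
    · refine Continuous.aestronglyMeasurable ?_
      have : Continuous (fun τ : ℝ => (x, (τ : ℂ))) := by fun_prop
      exact hDc.comp this
    · refine Filter.Eventually.of_forall fun τ hτ y hy => hC (y, τ) ⟨Metric.ball_subset_closedBall hy, ?_⟩
      rw [Set.uIoc_of_le zero_le_one] at hτ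
      exact ⟨hτ.1.le, hτ.2⟩
    · exact intervalIntegrable_const
    · exact Filter.Eventually.of_forall fun τ _ y _ => key y τ

theorem contDiff_dividedDifference {V : Type u} [NormedAddCommGroup V] [NormedSpace ℂ V]
    [FiniteDimensional ℂ V] {f a : V → ℂ} {v : V} (hf : ContDiff ℂ ∞ f) (ha : ContDiff ℂ ∞ a)
    (hper : ∀ (x : V) (m : ℤ), f (x + (2 * Real.pi * Complex.I * m) • v) = f x) :
    ContDiff ℂ ∞ (fun x => if Complex.exp (-a x) = 1 then -(fderiv ℂ f x v)
      else (f (x - a x • v) - f x) / (1 - Complex.exp (-a x))) := by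
  have hDf : ContDiff ℂ ∞ (fderiv ℂ f) := hf.fderiv_right (m := ∞) (by simp)
  rw [contDiff_iff_contDiffAt]
  intro x₀
  by_cases h0 : Complex.exp (-a x₀) = 1
  · obtain ⟨m, hm⟩ := Complex.exp_eq_one_iff.mp h0
    set K : V × ℂ → V →L[ℂ] ℂ := fun p => ∫ τ in (0 : ℝ)..1, fderiv ℂ f (p.1 - ((τ : ℂ) * p.2) • v) with hK
    have hKs : ContDiff ℂ ∞ K := by
      rw [contDiff_infty]
      intro n
      exact contDiff_param_integral n (fun q : (V × ℂ) × ℂ => fderiv ℂ f (q.1.1 - (q.2 * q.1.2) • v))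
        (hDf.comp (by fun_prop))
    set e : ℂ → ℂ := fun u => 1 - Complex.exp (-u) with he
    have hed : Differentiable ℂ e := by fun_prop
    set E : ℂ → ℂ := dslope e 0 with hE
    have hEd : Differentiable ℂ E := by
      rw [← differentiableOn_univ]
      exact (Complex.differentiableOn_dslope Filter.univ_mem).mpr hed.differentiableOn
    have hE0 : E 0 = 1 := by
      rw [hE, dslope_same]
      have : HasDerivAt e (-(Complex.exp (-0) * -1)) 0 :=
        ((hasDerivAt_neg (0 : ℂ)).cexp).const_sub 1
      rw [this.deriv]; simp
    have hEe : ∀ u, e u = u * E u := by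
      intro u
      have := sub_smul_dslope e 0 u
      simp only [sub_zero, smul_eq_mul] at this
      rw [hE, this]; simp [he]
    have hfK : ∀ x u, f (x - u • v) - f x = -(u * K (x, u) v) := by
      intro x u
      have hd : ∀ τ : ℝ, HasDerivAt (fun s : ℝ => f (x - ((s : ℂ) * u) • v))
          (fderiv ℂ f (x - ((τ : ℂ) * u) • v) (-(u • v))) τ := by
        intro τ
        have h1 := (hf.differentiable (by simp) (x - ((τ : ℂ) * u) • v)).hasFDerivAt
        have h2 : HasDerivAt (fun s : ℂ => x - (s * u) • v) (-(u • v)) (τ : ℂ) := by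
          have := (((hasDerivAt_id (τ : ℂ)).mul_const u).smul_const v).const_sub x
          simpa using this
        exact (h1.comp_hasDerivAt _ h2).comp_ofReal
      have hcont : Continuous fun τ : ℝ => fderiv ℂ f (x - ((τ : ℂ) * u) • v) :=
        hDf.continuous.comp (by fun_prop)
      have hint := intervalIntegral.integral_eq_sub_of_hasDerivAt (a := 0) (b := 1)
        (fun τ _ => hd τ) ((hcont.clm_apply continuous_const).intervalIntegrable _ _)
      have h3 : (∫ τ in (0 : ℝ)..1, fderiv ℂ f (x - ((τ : ℂ) * u) • v) (-(u • v)))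
          = K (x, u) (-(u • v)) := by
        rw [hK]
        exact ContinuousLinearMap.intervalIntegral_apply (hcont.intervalIntegrable _ _) _ |>.symm
      rw [h3] at hint
      simp only [map_neg, map_smul, smul_eq_mul] at hint
      rw [hint]; simp
    set w : V → ℂ := fun x => a x + m * (2 * Real.pi * Complex.I) with hw
    have hws : ContDiff ℂ ∞ w := ha.add contDiff_const
    have hw0 : w x₀ = 0 := by simp [hw, ← hm]
    have hexp : ∀ x, Complex.exp (-a x) = Complex.exp (-w x) := by
      intro x
      rw [Complex.exp_eq_exp_iff_exists_int]
      exact ⟨m, by simp [hw]⟩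
    have hmain : ContDiffAt ℂ ∞ (fun x => -(K (x, w x) v / E (w x))) x₀ := by
      refine ContDiffAt.neg (ContDiffAt.div ?_ ?_ ?_)
      · exact ((hKs.comp (contDiff_id.prodMk hws)).clm_apply contDiff_const).contDiffAt
      · exact (hEd.contDiff.comp hws).contDiffAt
      · rw [hw0, hE0]; exact one_ne_zero
    refine hmain.congr_of_eventuallyEq ?_
    have hne : ∀ᶠ x in nhds x₀, E (w x) ≠ 0 := by
      apply (hEd.continuous.comp hws.continuous).continuousAt.eventually_ne
      simp [hw0, hE0]
    filter_upwards [hne] with x hx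
    by_cases hwx : w x = 0
    · have : Complex.exp (-a x) = 1 := by rw [hexp, hwx]; simp
      rw [if_pos this, hwx, hE0, hK]
      simp
    · have h1 : 1 - Complex.exp (-a x) = w x * E (w x) := by rw [hexp, ← hEe]
      have h2 : Complex.exp (-a x) ≠ 1 := by
        intro h
        rw [h, sub_self] at h1
        exact mul_ne_zero hwx hx h1.symm
      have h3 : f (x - a x • v) = f (x - w x • v) := by
        rw [← hper (x - w x • v) m]
        congr 1
        simp only [hw]
        module
      rw [if_neg h2, h1, h3, hfK]
      field_simp
  · have hne : ∀ᶠ x in nhds x₀, Complex.exp (-a x) ≠ 1 :=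
      (by fun_prop : Continuous a → Continuous fun x => Complex.exp (-a x)) ha.continuous |>.continuousAt.eventually_ne h0
    have : ContDiffAt ℂ ∞ (fun x => (f (x - a x • v) - f x) / (1 - Complex.exp (-a x))) x₀ := by
      refine ContDiffAt.div ?_ ?_ (sub_ne_zero.mpr (Ne.symm h0))
      · exact ((hf.comp (contDiff_id.sub (ha.smul contDiff_const))).sub hf).contDiffAt
      · exact (contDiff_const.sub ha.neg.cexp).contDiffAt
    refine this.congr_of_eventuallyEq ?_
    filter_upwards [hne] with x hx
    rw [if_neg hx]

/-! ### Lattices, affine functionals and affine Weyl groups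

Throughout, `P` is a root system in a complex vector space: its roots are linear functionals on the
space `V` (`P.root' i x` is the number `(αᵢ, x)`) and its coroots `αᵢ^∨ = P.coroot i` are vectors
of `V`. -/

variable {ι : Type*} {M : Type*} {V : Type u} [AddCommGroup M] [Module ℂ M]
  [NormedAddCommGroup V] [NormedSpace ℂ V] (P : RootPairing ι ℂ M V)

/-- The coroot lattice `Q^∨`. -/
def corootLattice : AddSubgroup V := AddSubgroup.closure (Set.range P.coroot)

/-- The coweight lattice `P^∨`: the vectors at which all roots are integral. -/
def coweightLattice : AddSubgroup V where
  carrier := {v | ∀ i, ∃ k : ℤ, P.root' i v = k}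
  zero_mem' := fun i => ⟨0, by simp⟩
  add_mem' := by
    intro v w hv hw i
    obtain ⟨k, hk⟩ := hv i
    obtain ⟨l, hl⟩ := hw i
    exact ⟨k + l, by simp [hk, hl]⟩
  neg_mem' := by
    intro v hv i
    obtain ⟨k, hk⟩ := hv i
    exact ⟨-k, by simp [hk]⟩

/-- A linear functional on `V` is a weight if it is integral at all coroots. -/
def IsWeight (μ : V →ₗ[ℂ] ℂ) : Prop := ∀ i, ∃ k : ℤ, μ (P.coroot i) = k

/-- The affine root `[αᵢ, ℏ k]`, that is the affine functional `x ↦ (αᵢ, x) + ℏ k`. -/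
def affRoot (ℏ : ℂ) (i : ι) (k : ℤ) : V →ᵃ[ℂ] ℂ :=
  (P.root' i : V →ₗ[ℂ] ℂ).toAffineMap + AffineMap.const ℂ V (ℏ * k)

@[simp] lemma affRoot_apply (ℏ : ℂ) (i : ι) (k : ℤ) (x : V) :
    affRoot P ℏ i k x = P.root' i x + ℏ * k := by
  simp [affRoot]

/-- Translation by the vector `v`. -/
def translation (v : V) : V ≃ᵃ[ℂ] V := AffineEquiv.constVAdd ℂ V v

/-- The reflection `x ↦ x - ((αᵢ, x) + ℏ k) αᵢ^∨` in the zero hyperplane of `[αᵢ, ℏ k]`. -/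
def affRefl (ℏ : ℂ) (i : ι) (k : ℤ) : V ≃ᵃ[ℂ] V :=
  (P.coreflection i).toAffineEquiv.trans (translation (-((ℏ * k) • P.coroot i)))

@[simp] lemma affRefl_apply (ℏ : ℂ) (i : ι) (k : ℤ) (x : V) :
    affRefl P ℏ i k x = x - affRoot P ℏ i k x • P.coroot i := by
  simp [affRefl, translation, RootPairing.coreflection_apply]
  module

/-- The extended affine Weyl group `W ⋉ τ(P^∨)`, as a group of affine transformations of `V`:
it is generated by the reflections in the roots and by the shifts `τ(λ) : x ↦ x + ℏ λ` with
`λ ∈ P^∨`. -/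
def extAffWeyl (ℏ : ℂ) : Subgroup (V ≃ᵃ[ℂ] V) :=
  Subgroup.closure (Set.range (fun i => affRefl P ℏ i 0) ∪
    (fun v => translation (ℏ • v)) '' (coweightLattice P : Set V))

/-- The action `(g a)(x) = a (g⁻¹ x)` of affine transformations on affine functionals. -/
def actFunctional (g : V ≃ᵃ[ℂ] V) (a : V →ᵃ[ℂ] ℂ) : V →ᵃ[ℂ] ℂ :=
  a.comp (g⁻¹ : V ≃ᵃ[ℂ] V).toAffineMap

lemma actFunctional_one (a : V →ᵃ[ℂ] ℂ) : actFunctional 1 a = a := by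
  ext x; simp [actFunctional]

lemma actFunctional_mul (g h : V ≃ᵃ[ℂ] V) (a : V →ᵃ[ℂ] ℂ) :
    actFunctional (g * h) a = actFunctional g (actFunctional h a) := by
  ext x; simp [actFunctional]

/-- `θ` is the maximal root of the set `C` of roots with respect to the set `S` of simple roots of
`C`: it lies in `C`, and `θ - β` is a sum of elements of `S` for every `β` in `C`. -/
def IsMaximalRoot (S C : Set ι) (θ : ι) : Prop :=
  θ ∈ C ∧ ∀ j ∈ C, P.root θ - P.root j ∈ AddSubmonoid.closure (P.root '' S)

variable {P} (b : P.Base)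

/-- The nodes of the affine Dynkin diagram: `none` is the node `0`, and the others are the
simple roots. The affine simple root of a node is `[α, ℏ k]` with `α = nodeRoot` and
`k = nodeLevel`: `α₀ = [-θ, ℏ]`, and the other ones are `[αᵢ, 0]`. -/
abbrev Node : Type _ := Option b.support

/-- The gradient of an affine simple root (`P.reflectionPerm θ θ` is the index of `-θ`). -/
def nodeRoot (θ : ι) : Node b → ι
  | none => P.reflectionPerm θ θ
  | some i => i

/-- The coefficient of `ℏ` in an affine simple root. -/
def nodeLevel : Node b → ℤ
  | none => 1
  | some _ => 0

/-- The affine simple root of a node. -/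
def simpleAff (ℏ : ℂ) (θ : ι) (j : Node b) : V →ᵃ[ℂ] ℂ :=
  affRoot P ℏ (nodeRoot b θ j) (nodeLevel b j)

/-- The affine simple reflection `s_j` of a node. -/
def simpleRefl (ℏ : ℂ) (θ : ι) (j : Node b) : V ≃ᵃ[ℂ] V :=
  affRefl P ℏ (nodeRoot b θ j) (nodeLevel b j)

/-- The group `Π` of elements of the extended affine Weyl group that preserve the set of affine
simple roots. -/
def groupPi (ℏ : ℂ) (θ : ι) : Subgroup (V ≃ᵃ[ℂ] V) where
  carrier := {g | g ∈ extAffWeyl P ℏ ∧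
    actFunctional g '' Set.range (simpleAff b ℏ θ) = Set.range (simpleAff b ℏ θ)}
  one_mem' := ⟨one_mem _, by
    rw [funext actFunctional_one, Set.image_id']⟩
  mul_mem' := by
    rintro g h ⟨hg, hg'⟩ ⟨hh, hh'⟩
    refine ⟨mul_mem hg hh, ?_⟩
    rw [funext (actFunctional_mul g h), ← Set.image_image, hh', hg']
  inv_mem' := by
    rintro g ⟨hg, hg'⟩
    refine ⟨inv_mem hg, ?_⟩
    conv_lhs => rw [← hg']
    rw [Set.image_image]
    simp_rw [← actFunctional_mul, inv_mul_cancel, actFunctional_one, Set.image_id']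

variable (P)

/-- The lattice of the affine functionals `[μ, ℏ k / ε₀]`, where `μ` is a weight and `k` is an
integer. -/
def affWeightLattice (ℏ : ℂ) (ε₀ : ℤ) : AddSubgroup (V →ᵃ[ℂ] ℂ) where
  carrier := {μ | IsWeight P μ.linear ∧ ∃ k : ℤ, μ 0 = ℏ * k / ε₀}
  zero_mem' := ⟨fun i => ⟨0, by simp⟩, 0, by simp⟩
  add_mem' := by
    rintro μ ν ⟨hμ, k, hk⟩ ⟨hν, l, hl⟩
    refine ⟨fun i => ?_, k + l, ?_⟩
    · obtain ⟨p, hp⟩ := hμ i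
      obtain ⟨q, hq⟩ := hν i
      exact ⟨p + q, by simp [hp, hq]⟩
    · simp [hk, hl]; ring
  neg_mem' := by
    rintro μ ⟨hμ, k, hk⟩
    refine ⟨fun i => ?_, -k, ?_⟩
    · obtain ⟨p, hp⟩ := hμ i
      exact ⟨-p, by simp [hp]⟩
    · simp [hk]; ring

/-! ### The function space and the operators of the polynomial representation -/

/-- The algebra of entire functions on `V` (complex-smooth functions) which are periodic with the
lattice of periods `2πi Q^∨`. -/
def periodicFunctions : Subalgebra ℂ (V → ℂ) where
  carrier := {f | ContDiff ℂ ∞ f ∧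
    ∀ x, ∀ v ∈ corootLattice P, f (x + (2 * Real.pi * Complex.I) • v) = f x}
  mul_mem' := by
    rintro f g ⟨hf, hf'⟩ ⟨hg, hg'⟩
    exact ⟨hf.mul hg, fun x v hv => by simp [hf' x v hv, hg' x v hv]⟩
  add_mem' := by
    rintro f g ⟨hf, hf'⟩ ⟨hg, hg'⟩
    exact ⟨hf.add hg, fun x v hv => by simp [hf' x v hv, hg' x v hv]⟩
  algebraMap_mem' := fun c => ⟨contDiff_const, fun _ _ _ => rfl⟩

lemma contDiff_affineMap [FiniteDimensional ℂ V] (μ : V →ᵃ[ℂ] ℂ) : ContDiff ℂ ∞ μ := by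
  have h : (μ : V → ℂ) = fun x => LinearMap.toContinuousLinearMap μ.linear x + μ 0 := by
    ext x
    simpa using congrFun (AffineMap.decomp μ) x
  rw [h]
  exact (ContinuousLinearMap.contDiff _).add contDiff_const

lemma weight_corootLattice {μ : V →ₗ[ℂ] ℂ} (hμ : IsWeight P μ) {v : V}
    (hv : v ∈ corootLattice P) : ∃ k : ℤ, μ v = k := by
  induction hv using AddSubgroup.closure_induction with
  | mem x hx => obtain ⟨i, rfl⟩ := hx; exact hμ i
  | zero => exact ⟨0, by simp⟩
  | add x y _ _ hx hy =>
    obtain ⟨k, hk⟩ := hx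
    obtain ⟨l, hl⟩ := hy
    exact ⟨k + l, by simp [hk, hl]⟩
  | neg x _ hx => obtain ⟨k, hk⟩ := hx; exact ⟨-k, by simp [hk]⟩

lemma affine_add_period {μ : V →ᵃ[ℂ] ℂ} (hμ : IsWeight P μ.linear) {v : V}
    (hv : v ∈ corootLattice P) (x : V) :
    ∃ k : ℤ, μ (x + (2 * Real.pi * Complex.I) • v) = μ x + k * (2 * Real.pi * Complex.I) := by
  obtain ⟨k, hk⟩ := weight_corootLattice P hμ hv
  refine ⟨k, ?_⟩
  have := μ.map_vadd x ((2 * Real.pi * Complex.I) • v)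
  simp only [vadd_eq_add, map_smul, smul_eq_mul, hk] at this
  rw [add_comm x, this]
  ring

/-- The function `e^{μ(x)}` for an affine functional `μ` whose linear part is a weight. -/
def expFunction [FiniteDimensional ℂ V] (μ : V →ᵃ[ℂ] ℂ) (hμ : IsWeight P μ.linear) :
    periodicFunctions P :=
  ⟨fun x => Complex.exp (μ x), (contDiff_affineMap μ).cexp, fun x v hv => by
    obtain ⟨k, hk⟩ := affine_add_period P hμ hv x
    show Complex.exp _ = Complex.exp _
    rw [hk, Complex.exp_eq_exp_iff_exists_int]
    exact ⟨k, rfl⟩⟩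

/-- The operator `X^μ` of multiplication by `e^{μ(x)}`. -/
def opX [FiniteDimensional ℂ V] (ℏ : ℂ) (ε₀ : ℤ) (μ : affWeightLattice P ℏ ε₀) :
    Module.End ℂ (periodicFunctions P) :=
  LinearMap.mulLeft ℂ (expFunction P μ.1 μ.2.1)

lemma coreflection_mem_corootLattice (i : ι) {v : V} (hv : v ∈ corootLattice P) :
    P.coreflection i v ∈ corootLattice P := by
  induction hv using AddSubgroup.closure_induction with
  | mem x hx =>
    obtain ⟨j, rfl⟩ := hx
    rw [← P.coroot_reflectionPerm]
    exact AddSubgroup.subset_closure ⟨_, rfl⟩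
  | zero => simp
  | add x y _ _ hx hy => rw [map_add]; exact add_mem hx hy
  | neg x _ hx => rw [map_neg]; exact neg_mem hx

lemma exists_linear_of_mem_extAffWeyl {ℏ : ℂ} {g : V ≃ᵃ[ℂ] V} (hg : g ∈ extAffWeyl P ℏ) :
    ∀ v ∈ corootLattice P, ∃ w ∈ corootLattice P, ∀ (x : V) (c : ℂ),
      g (x + c • v) = g x + c • w := by
  induction hg using Subgroup.closure_induction'' with
  | one => exact fun v hv => ⟨v, hv, fun x c => rfl⟩
  | mul g h _ _ hg hh =>
    intro v hv
    obtain ⟨w, hw, hw'⟩ := hh v hv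
    obtain ⟨u, hu, hu'⟩ := hg w hw
    exact ⟨u, hu, fun x c => by simp [hw', hu']⟩
  | mem g hg =>
    intro v hv
    rcases hg with ⟨i, rfl⟩ | ⟨l, -, rfl⟩
    · refine ⟨_, coreflection_mem_corootLattice P i hv, fun x c => ?_⟩
      simp [RootPairing.coreflection_apply]
      module
    · refine ⟨v, hv, fun x c => ?_⟩
      simp [translation, add_assoc]
  | inv_mem g hg =>
    intro v hv
    rcases hg with ⟨i, rfl⟩ | ⟨l, -, rfl⟩
    · refine ⟨_, coreflection_mem_corootLattice P i hv, fun x c => ?_⟩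
      have h : ∀ y, (affRefl P ℏ i 0)⁻¹ y = affRefl P ℏ i 0 y := by
        intro y
        show (affRefl P ℏ i 0).symm y = _
        rw [AffineEquiv.symm_apply_eq]
        simp
        module
      simp [h, RootPairing.coreflection_apply]
      module
    · refine ⟨v, hv, fun x c => ?_⟩
      show (translation (ℏ • l)).symm _ = (translation (ℏ • l)).symm _ + _
      simp [translation, add_assoc]

lemma comp_mem_periodicFunctions [FiniteDimensional ℂ V] {ℏ : ℂ} {g : V ≃ᵃ[ℂ] V}
    (hg : g ∈ extAffWeyl P ℏ) {f : V → ℂ} (hf : f ∈ periodicFunctions P) :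
    (fun x => f (g x)) ∈ periodicFunctions P := by
  refine ⟨hf.1.comp ?_, fun x v hv => ?_⟩
  · have h : (g : V → V) = fun x => LinearMap.toContinuousLinearMap g.linear.toLinearMap x + g 0 := by
      ext x
      simpa using congrFun (AffineMap.decomp g.toAffineMap) x
    rw [h]
    exact (ContinuousLinearMap.contDiff _).add contDiff_const
  · obtain ⟨w, hw, hw'⟩ := exists_linear_of_mem_extAffWeyl P hg v hv
    show f _ = f _
    rw [hw', hf.2 _ w hw]

/-- The operator `f(x) ↦ f(g⁻¹ x)` for an element `g` of the extended affine Weyl group. -/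
def opWeyl [FiniteDimensional ℂ V] {ℏ : ℂ} (g : V ≃ᵃ[ℂ] V) (hg : g ∈ extAffWeyl P ℏ) :
    Module.End ℂ (periodicFunctions P) where
  toFun f := ⟨fun x => f.1 (g⁻¹ x), comp_mem_periodicFunctions P (inv_mem hg) f.2⟩
  map_add' _ _ := rfl
  map_smul' _ _ := rfl

/-- The function `(f(s x) - f(x)) / (1 - e^{-a(x)})`, where `a` is the affine root `[αᵢ, ℏ k]` and
`s` is its reflection, extended to the zeros of the denominator by its limit values. -/
def dividedDifference (ℏ : ℂ) (i : ι) (k : ℤ) (f : V → ℂ) (x : V) : ℂ :=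
  open Classical in
  if Complex.exp (-(affRoot P ℏ i k x)) = 1 then -(fderiv ℂ f x (P.coroot i))
  else (f (affRefl P ℏ i k x) - f x) / (1 - Complex.exp (-(affRoot P ℏ i k x)))

lemma isWeight_root [P.IsCrystallographic] (i : ι) : IsWeight P (P.root' i) := by
  intro j
  obtain ⟨k, hk⟩ := P.exists_value (S := ℤ) i j
  exact ⟨k, by simpa using hk.symm⟩

lemma affRoot_linear (ℏ : ℂ) (i : ι) (k : ℤ) : (affRoot P ℏ i k).linear = P.root' i := by
  simp [affRoot]

lemma exp_affRoot_period [P.IsCrystallographic] (ℏ : ℂ) (i : ι) (k : ℤ) {v : V}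
    (hv : v ∈ corootLattice P) (x : V) :
    Complex.exp (-(affRoot P ℏ i k (x + (2 * Real.pi * Complex.I) • v))) =
      Complex.exp (-(affRoot P ℏ i k x)) := by
  obtain ⟨m, hm⟩ := affine_add_period P (μ := affRoot P ℏ i k)
    (by rw [affRoot_linear]; exact isWeight_root P i) hv x
  rw [hm, Complex.exp_eq_exp_iff_exists_int]
  exact ⟨-m, by push_cast; ring⟩

lemma dividedDifference_mem [FiniteDimensional ℂ V] [P.IsCrystallographic] (ℏ : ℂ) (i : ι) (k : ℤ)
    {f : V → ℂ} (hf : f ∈ periodicFunctions P) :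
    dividedDifference P ℏ i k f ∈ periodicFunctions P := by
  refine ⟨?_, fun x v hv => ?_⟩
  · have h := contDiff_dividedDifference (v := P.coroot i) hf.1
      (contDiff_affineMap (affRoot P ℏ i k)) (fun x m => by
        have h1 : m • P.coroot i ∈ corootLattice P :=
          zsmul_mem (K := corootLattice P) (AddSubgroup.subset_closure (Set.mem_range_self i)) m
        rw [← hf.2 x _ h1, mul_smul, Int.cast_smul_eq_zsmul])
    convert! h using 2 with x
    simp only [dividedDifference, affRefl_apply]
  · have h1 := exp_affRoot_period P ℏ i k hv x
    have h2 : fderiv ℂ f (x + (2 * Real.pi * Complex.I) • v) = fderiv ℂ f x := by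
      rw [← fderiv_comp_add_right]
      congr 1
      funext y
      exact hf.2 y v hv
    have h3 : f (affRefl P ℏ i k (x + (2 * Real.pi * Complex.I) • v)) =
        f (affRefl P ℏ i k x) := by
      rw [← hf.2 (affRefl P ℏ i k x) _ (coreflection_mem_corootLattice P i hv)]
      congr 1
      simp [RootPairing.coreflection_apply]
      module
    simp only [dividedDifference, h1, h2, h3, hf.2 x v hv]

lemma dividedDifference_add [FiniteDimensional ℂ V] (ℏ : ℂ) (i : ι) (k : ℤ) {f g : V → ℂ}
    (hf : f ∈ periodicFunctions P) (hg : g ∈ periodicFunctions P) (x : V) :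
    dividedDifference P ℏ i k (f + g) x =
      dividedDifference P ℏ i k f x + dividedDifference P ℏ i k g x := by
  unfold dividedDifference
  split_ifs
  · rw [fderiv_add (hf.1.differentiable (by simp) x) (hg.1.differentiable (by simp) x)]
    simp; ring
  · simp; ring

lemma dividedDifference_smul (ℏ : ℂ) (i : ι) (k : ℤ) (c : ℂ) {f : V → ℂ}
    (hf : f ∈ periodicFunctions P) (x : V) :
    dividedDifference P ℏ i k (c • f) x = c * dividedDifference P ℏ i k f x := by
  unfold dividedDifference
  split_ifs
  · rw [fderiv_const_smul (hf.1.differentiable (by simp) x)]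
    simp
  · simp; ring

/-- The Demazure–Lusztig operator
`T = t + (t⁻¹ - t e^{-a(x)}) / (1 - e^{-a(x)}) (s - 1)`, where `a` is the affine root `[αᵢ, ℏ k]` and
`s` is its reflection. -/
def opT [FiniteDimensional ℂ V] [P.IsCrystallographic] (ℏ : ℂ) (i : ι) (k : ℤ) (t : ℂ) :
    Module.End ℂ (periodicFunctions P) where
  toFun f := ⟨fun x => t * f.1 x +
      (t⁻¹ - t * Complex.exp (-(affRoot P ℏ i k x))) * dividedDifference P ℏ i k f.1 x, by
    have h := dividedDifference_mem P ℏ i k f.2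
    refine ⟨(contDiff_const.mul f.2.1).add ((contDiff_const.sub (contDiff_const.mul
      (contDiff_affineMap (affRoot P ℏ i k)).neg.cexp)).mul h.1), fun x v hv => ?_⟩
    simp only [f.2.2 x v hv, h.2 x v hv, exp_affRoot_period P ℏ i k hv x]⟩
  map_add' f g := by
    ext x
    show t * (f.1 x + g.1 x) + _ * dividedDifference P ℏ i k (f.1 + g.1) x =
      (t * f.1 x + _ * dividedDifference P ℏ i k f.1 x) +
      (t * g.1 x + _ * dividedDifference P ℏ i k g.1 x)
    rw [dividedDifference_add P ℏ i k f.2 g.2]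
    ring
  map_smul' c f := by
    ext x
    show t * (c * f.1 x) + _ * dividedDifference P ℏ i k (c • f.1) x =
      c * (t * f.1 x + _ * dividedDifference P ℏ i k f.1 x)
    rw [dividedDifference_smul P ℏ i k c f.2]
    ring

/-- Off the zeros of the denominator, the operator `T` is given by the usual formula. -/
lemma opT_apply [FiniteDimensional ℂ V] [P.IsCrystallographic] (ℏ : ℂ) (i : ι) (k : ℤ) (t : ℂ)
    (f : periodicFunctions P) (x : V) (hx : Complex.exp (-(affRoot P ℏ i k x)) ≠ 1) :
    (opT P ℏ i k t f).1 x =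
      (t - t⁻¹) / (1 - Complex.exp (-(affRoot P ℏ i k x))) * f.1 x +
      (t⁻¹ - t * Complex.exp (-(affRoot P ℏ i k x))) / (1 - Complex.exp (-(affRoot P ℏ i k x))) *
        f.1 (affRefl P ℏ i k x) := by
  show t * f.1 x + _ * dividedDifference P ℏ i k f.1 x = _
  have h : 1 - Complex.exp (-(affRoot P ℏ i k x)) ≠ 0 := sub_ne_zero.mpr (Ne.symm hx)
  rw [dividedDifference, if_neg hx]
  generalize affRefl P ℏ i k x = y
  field_simp
  ring

/-! ### The double affine Hecke algebra and its polynomial representation -/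

/-- Generators of the double affine Hecke algebra: `T_j` for the nodes `j`, `X^μ` for `μ` in the
lattice of affine weights, and the elements of the group `Π`. -/
inductive DahaGen (b : P.Base) (ℏ : ℂ) (ε₀ : ℤ) (θ : ι) : Type _
  | T (j : Node b) : DahaGen b ℏ ε₀ θ
  | X (μ : affWeightLattice P ℏ ε₀) : DahaGen b ℏ ε₀ θ
  | pi (g : groupPi b ℏ θ) : DahaGen b ℏ ε₀ θ

variable {P}

/-- The alternating product `a b a ⋯` with `n` factors. -/
def altProd {A : Type*} [Monoid A] (a b : A) : ℕ → A
  | 0 => 1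
  | n + 1 => a * altProd b a n

/-- The parameter `t_j` of a node. -/
def nodeT (θ : ι) (t : ι → ℤ → ℂ) (j : Node b) : ℂ := t (nodeRoot b θ j) (nodeLevel b j)

section
variable (ℏ : ℂ) (ε₀ : ℤ) (θ : ι)

/-- `T_j` in the free algebra. -/
def genT (j : Node b) : FreeAlgebra ℂ (DahaGen P b ℏ ε₀ θ) := FreeAlgebra.ι ℂ (DahaGen.T j)

/-- `X^μ` in the free algebra. -/
def genX (μ : affWeightLattice P ℏ ε₀) : FreeAlgebra ℂ (DahaGen P b ℏ ε₀ θ) :=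
  FreeAlgebra.ι ℂ (DahaGen.X μ)

/-- The elements of `Π` in the free algebra. -/
def genPi (g : groupPi b ℏ θ) : FreeAlgebra ℂ (DahaGen P b ℏ ε₀ θ) :=
  FreeAlgebra.ι ℂ (DahaGen.pi g)

/-- The defining relations of the double affine Hecke algebra. In the braid relation,
`orderOf (s_i * s_j)` is the order of `s_i s_j`, which is `0` when the order is infinite. The relation
`T_j⁻¹ X^μ T_j⁻¹ = X^{μ - α_j}` is written as `T_j X^{μ - α_j} T_j = X^μ`, and
`π T_i π⁻¹ = T_j`, `π X^μ π⁻¹ = X^{π μ}` as `π T_i = T_j π`, `π X^μ = X^{π μ} π`; the elements `T_j`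
and `π` are invertible by the other relations. -/
inductive DahaRel (t : ι → ℤ → ℂ) : FreeAlgebra ℂ (DahaGen P b ℏ ε₀ θ) →
    FreeAlgebra ℂ (DahaGen P b ℏ ε₀ θ) → Prop
  | X_add (μ ν : affWeightLattice P ℏ ε₀) :
      DahaRel t (genX b ℏ ε₀ θ (μ + ν)) (genX b ℏ ε₀ θ μ * genX b ℏ ε₀ θ ν)
  | X_const (ν : affWeightLattice P ℏ ε₀) (c : ℂ) (hc : ν.1 = AffineMap.const ℂ V c) :
      DahaRel t (genX b ℏ ε₀ θ ν) (algebraMap ℂ _ (Complex.exp c))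
  | quadratic (j : Node b) :
      DahaRel t ((genT b ℏ ε₀ θ j - algebraMap ℂ _ (nodeT b θ t j)) *
        (genT b ℏ ε₀ θ j + algebraMap ℂ _ (nodeT b θ t j)⁻¹)) 0
  | braid (i j : Node b) (hij : i ≠ j)
      (hfin : orderOf (simpleRefl b ℏ θ i * simpleRefl b ℏ θ j) ≠ 0) :
      DahaRel t
        (altProd (genT b ℏ ε₀ θ i) (genT b ℏ ε₀ θ j)
          (orderOf (simpleRefl b ℏ θ i * simpleRefl b ℏ θ j)))
        (altProd (genT b ℏ ε₀ θ j) (genT b ℏ ε₀ θ i)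
          (orderOf (simpleRefl b ℏ θ i * simpleRefl b ℏ θ j)))
  | pi_one : DahaRel t (genPi b ℏ ε₀ θ 1) 1
  | pi_mul (g h : groupPi b ℏ θ) :
      DahaRel t (genPi b ℏ ε₀ θ (g * h)) (genPi b ℏ ε₀ θ g * genPi b ℏ ε₀ θ h)
  | pi_T (g : groupPi b ℏ θ) (i j : Node b)
      (hg : actFunctional g.1 (simpleAff b ℏ θ i) = simpleAff b ℏ θ j) :
      DahaRel t (genPi b ℏ ε₀ θ g * genT b ℏ ε₀ θ i) (genT b ℏ ε₀ θ j * genPi b ℏ ε₀ θ g)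
  | T_X_one (j : Node b) (μ ν : affWeightLattice P ℏ ε₀)
      (hμ : μ.1.linear (P.coroot (nodeRoot b θ j)) = 1) (hν : ν.1 = μ.1 - simpleAff b ℏ θ j) :
      DahaRel t (genT b ℏ ε₀ θ j * genX b ℏ ε₀ θ ν * genT b ℏ ε₀ θ j) (genX b ℏ ε₀ θ μ)
  | T_X_zero (j : Node b) (μ : affWeightLattice P ℏ ε₀)
      (hμ : μ.1.linear (P.coroot (nodeRoot b θ j)) = 0) :
      DahaRel t (genT b ℏ ε₀ θ j * genX b ℏ ε₀ θ μ) (genX b ℏ ε₀ θ μ * genT b ℏ ε₀ θ j)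
  | pi_X (g : groupPi b ℏ θ) (μ ν : affWeightLattice P ℏ ε₀)
      (hν : ν.1 = actFunctional g.1 μ.1) :
      DahaRel t (genPi b ℏ ε₀ θ g * genX b ℏ ε₀ θ μ) (genX b ℏ ε₀ θ ν * genPi b ℏ ε₀ θ g)

/-- The double affine Hecke algebra. -/
abbrev Daha (t : ι → ℤ → ℂ) : Type _ := RingQuot (DahaRel b ℏ ε₀ θ t)

/-- The class of a generator in the double affine Hecke algebra. -/
def Daha.gen (t : ι → ℤ → ℂ) (x : DahaGen P b ℏ ε₀ θ) : Daha b ℏ ε₀ θ t :=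
  RingQuot.mkAlgHom ℂ (DahaRel b ℏ ε₀ θ t) (FreeAlgebra.ι ℂ x)

variable [FiniteDimensional ℂ V] [P.IsCrystallographic]

/-- The operator on the space of periodic entire functions by which a generator acts in the
polynomial representation. -/
def genOperator (t : ι → ℤ → ℂ) : DahaGen P b ℏ ε₀ θ → Module.End ℂ (periodicFunctions P)
  | .T j => opT P ℏ (nodeRoot b θ j) (nodeLevel b j) (nodeT b θ t j)
  | .X μ => opX P ℏ ε₀ μ
  | .pi g => opWeyl P g.1 g.2.1

/-- The algebra of operators generated by all `T_j`, `X^μ` and `π`: the image of the double affine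
Hecke algebra in the polynomial representation. -/
def dahaOperators (t : ι → ℤ → ℂ) : Subalgebra ℂ (Module.End ℂ (periodicFunctions P)) :=
  Algebra.adjoin ℂ (Set.range (genOperator b ℏ ε₀ θ t))

/-- `ρ` is the polynomial representation of the double affine Hecke algebra. -/
def IsPolynomialRepresentation (t : ι → ℤ → ℂ)
    (ρ : Daha b ℏ ε₀ θ t →ₐ[ℂ] Module.End ℂ (periodicFunctions P)) : Prop :=
  ∀ x, ρ (Daha.gen b ℏ ε₀ θ t x) = genOperator b ℏ ε₀ θ t x

end

/-! ### The subsystem `R₀` and its irreducible components -/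

variable (P)

/-- The roots in the linear span of `S₀`. -/
def subRoots (S₀ : Finset ι) : Set ι := {i | P.root i ∈ Submodule.span ℂ (P.root '' S₀)}

/-- Two roots of the subsystem are not orthogonal. -/
def NonOrthogonal (S₀ : Finset ι) (i j : subRoots P S₀) : Prop := P.pairing i j ≠ 0

/-- The irreducible components of the subsystem are the classes of the equivalence relation generated
by non-orthogonality. -/
abbrev Component (S₀ : Finset ι) : Type _ := Quot (NonOrthogonal P S₀)

variable {P} in
/-- The set `R_ℓ` of the roots of a component. -/
def compRoots {S₀ : Finset ι} (l : Component P S₀) : Set ι :=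
  {i | ∃ h : i ∈ subRoots P S₀, Quot.mk (NonOrthogonal P S₀) ⟨i, h⟩ = l}

variable {P} in
/-- The simple roots `S_ℓ = S₀ ∩ R_ℓ` of a component. -/
def compSimple {S₀ : Finset ι} (l : Component P S₀) : Finset ι :=
  open Classical in S₀.filter (fun i => i ∈ compRoots l)

/-- Two sets of roots are isomorphic if there is a bijection between them which preserves all the
integers `(α, β^∨)`. -/
def RootsIso (C C' : Set ι) : Prop :=
  ∃ e : C ≃ C', ∀ i j : C, P.pairing (e i) (e j) = P.pairing i j

/-- A set `C` of roots is isomorphic to the root system `A_k`, which consists of the vectors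
`ε_p - ε_q` for `p ≠ q` in `{0, …, k}` (so that `(α, β^∨)` is the scalar product of `α` and `β`). -/
def IsTypeA (C : Set ι) (k : ℕ) : Prop :=
  ∃ e : C ≃ {p : Fin (k + 1) × Fin (k + 1) // p.1 ≠ p.2}, ∀ i j : C,
    P.pairing i j =
      (Pi.single (e i).1.1 1 - Pi.single (e i).1.2 1 : Fin (k + 1) → ℂ) ⬝ᵥ
        (Pi.single (e j).1.1 1 - Pi.single (e j).1.2 1)

variable {P}

/-- For a maximal root `θ = ∑ nⱼ αⱼ` (of the root system or of a component), the generalized Coxeter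
number `η_θ + ∑ nⱼ η_{αⱼ}`. The sum may be taken over all simple roots: for a component, the `nⱼ` of
simple roots outside the component vanish. -/
def coxeterNumber [P.IsRootSystem] (η : ι → ℂ) (θ : ι) : ℂ :=
  η θ + ∑ j : b.support, b.toWeightBasis.repr (P.root θ) j * η j

/-! ### The arrangement and its ideal -/

/-- The set `Ξ_r(w)` of functions `ξ` with non-negative integer values on `wS₀`. A function `ξ` is
given here on all roots, but only its values on `wS₀` matter, here and in the plane it defines. -/
def shiftFunctions {S₀ : Finset ι} (r : Component P S₀ → ℕ) [Finite ι] [P.IsCrystallographic]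
    (w : P.weylGroup) : Set (ι → ℕ) :=
  {ξ | (∀ α ∈ P.weylGroupToPerm w '' S₀, ξ α = 0 → b.IsPos α) ∧
    ∀ l, ∑ α ∈ compSimple l, ξ (P.weylGroupToPerm w α) ≤ r l}

variable (P) in
/-- The plane `H_η(S; ξ)`. -/
def plane (ℏ : ℂ) (η : ι → ℂ) (S : Set ι) (ξ : ι → ℕ) : Set V :=
  {x | ∀ α ∈ S, P.root' α x = η α - ℏ * ξ α}

/-- The union `D_r` of planes. -/
def arrangement [Finite ι] [P.IsCrystallographic] (ℏ : ℂ) (η : ι → ℂ) {S₀ : Finset ι}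
    (r : Component P S₀ → ℕ) : Set V :=
  ⋃ w : P.weylGroup, ⋃ ξ ∈ shiftFunctions b r w, plane P ℏ η (P.weylGroupToPerm w '' S₀) ξ

variable (P) in
/-- The ideal of the functions that vanish on `D`. -/
def vanishingIdeal (D : Set V) : Ideal (periodicFunctions P) where
  carrier := {f | ∀ x ∈ D, f.1 x = 0}
  zero_mem' := fun _ _ => rfl
  add_mem' := by
    intro f g hf hg x hx
    show f.1 x + g.1 x = 0
    rw [hf x hx, hg x hx, add_zero]
  smul_mem' := by
    intro c f hf x hx
    show c.1 x * f.1 x = 0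
    rw [hf x hx, mul_zero]

end DahaIdeals

end

/-! The arrangement has a description that treats all nodes of the extended Dynkin diagrams of the
components alike. Adjoin `-θ_ℓ` to each `S_ℓ`. Then `D_r` consists of the points `x` for which, for
some `w ∈ W`, every `α` in these extended bases has a positive affine root `[wα, ℏ k_α]` taking the
value `η_α` at `x` (`arrangement_eq_extArrangement`). The relation `-θ_ℓ + ∑ n_α α = 0` and the
Coxeter number condition force `k_{-θ_ℓ} + ∑ n_α k_α = r_ℓ + 1`. From a function `ξ` one reads off
the missing level at `-θ_ℓ`, which is at least one. Conversely, in each component some node has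
coefficient one and positive level: in type `A` all coefficients are one, and otherwise `r_ℓ = 0`.
Deleting such nodes leaves a `W`-conjugate of `S₀` (`exists_weyl_image_eq_erase`), and the remaining
levels sum to at most `r_ℓ`.

In this form invariance is a statement about positive affine roots. The group `Π` preserves
positivity, so it preserves the arrangement (`extArrangement_groupPi`). The reflection `s_j`
preserves positivity of every affine root except `α_j`, so `s_j x` stays in the arrangement unless
`α_j` is one of the affine roots defining the plane (`HasLevels.affRefl_mem`). In that exceptional
case `α_j(x) = η`, and the numerator `t⁻¹ - t e^{-α_j(x)}` vanishes because `t² = e^η`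
(`opT_eq_zero_of_value`).

What remains is a possible zero of `1 - e^{-α_j}` when `α_j` is not a defining root. If its gradient
is outside `w R₀`, one can move along the plane transversally to that zero set and use continuity
(`HasLevels.exists_direction`, `opT_eq_zero_of_direction`). If the gradient lies in a type `A`
component, coprimality and `ℏ ∉ πiℚ` exclude a zero (`HasLevels.exp_ne_one_of_isTypeA`). If it lies
in another component, `r_ℓ = 0` forces `α_j` to be a defining root after all
(`HasLevels.exists_eq_node`). -/

namespace DahaIdeals

variable {ι : Type*} {M : Type*} {V : Type*} [AddCommGroup M] [Module ℂ M]
  [NormedAddCommGroup V] [NormedSpace ℂ V] {P : RootPairing ι ℂ M V}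

/-! ### Coordinates of roots in a base -/

section Coord

variable (b : P.Base)

/-- The coordinates of a root in the basis of simple roots. -/
noncomputable def coord (γ : ι) : ι → ℤ := (b.exists_root_eq_sum_int γ).choose

lemma root_eq_sum_coord (γ : ι) : P.root γ = ∑ j ∈ b.support, coord b γ j • P.root j :=
  (b.exists_root_eq_sum_int γ).choose_spec.2.2

lemma coord_nonneg_or_nonpos (γ : ι) : (∀ j, 0 ≤ coord b γ j) ∨ ∀ j, coord b γ j ≤ 0 :=
  (b.exists_root_eq_sum_int γ).choose_spec.2.1.imp (fun h j => h.le j) (fun h j => h.le j)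

lemma coord_eq_zero {γ j : ι} (hj : j ∉ b.support) : coord b γ j = 0 := by
  by_contra h
  exact hj (by simpa using (b.exists_root_eq_sum_int γ).choose_spec.1 h)

lemma coeff_eq_of_sum_eq {f g : ι → ℤ}
    (h : ∑ j ∈ b.support, f j • P.root j = ∑ j ∈ b.support, g j • P.root j) :
    ∀ j ∈ b.support, f j = g j := by
  intro j hj
  have h1 := linearIndepOn_finset_iff.mp b.linearIndepOn_root (fun j => ((f j - g j : ℤ) : ℂ)) (by
    simp only [Int.cast_smul_eq_zsmul, sub_smul, Finset.sum_sub_distrib, h, sub_self]) j hj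
  have h2 : f j - g j = 0 := by exact_mod_cast h1
  omega

lemma coord_eq_of_root_eq {γ : ι} {f : ι → ℤ} (h : P.root γ = ∑ j ∈ b.support, f j • P.root j) :
    ∀ j ∈ b.support, coord b γ j = f j :=
  coeff_eq_of_sum_eq b (by rw [← root_eq_sum_coord, h])

lemma coord_eq_sum {κ : Type*} {s : Finset κ} {a : κ → ℤ} {f : κ → ι} {γ : ι}
    (h : P.root γ = ∑ i ∈ s, a i • P.root (f i)) (j : ι) :
    coord b γ j = ∑ i ∈ s, a i * coord b (f i) j := by
  by_cases hj : j ∈ b.support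
  · refine coord_eq_of_root_eq b (f := fun j => ∑ i ∈ s, a i * coord b (f i) j) ?_ j hj
    simp_rw [h, Finset.sum_smul, mul_smul]
    rw [Finset.sum_comm]
    refine Finset.sum_congr rfl fun i _ => ?_
    rw [← Finset.smul_sum, ← root_eq_sum_coord]
  · simp [coord_eq_zero b hj]

/-- The value at a root of the integral functional with given values at the simple roots. -/
noncomputable def val (c : ι → ℤ) (γ : ι) : ℤ := ∑ j ∈ b.support, coord b γ j * c j

lemma val_eq_sum {κ : Type*} {s : Finset κ} {a : κ → ℤ} {f : κ → ι} {γ : ι} (c : ι → ℤ)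
    (h : P.root γ = ∑ i ∈ s, a i • P.root (f i)) :
    val b c γ = ∑ i ∈ s, a i * val b c (f i) := by
  simp_rw [val, coord_eq_sum b h, Finset.sum_mul, Finset.mul_sum]
  rw [Finset.sum_comm]
  simp_rw [mul_assoc]

lemma height_eq_val (γ : ι) : b.height γ = val b 1 γ := by
  simp [val, coord, RootPairing.Base.height]

lemma coord_of_mem_support {i : ι} (hi : i ∈ b.support) (j : ι) [Decidable (j = i)] :
    coord b i j = if j = i then 1 else 0 := by
  classical
  by_cases hj : j ∈ b.support
  · rw [coord_eq_of_root_eq b (f := fun j => if j = i then 1 else 0) (by simp [hi]) j hj]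
    congr
  · rw [coord_eq_zero b hj, if_neg]
    rintro rfl
    exact hj hi

lemma val_of_mem_support {i : ι} (hi : i ∈ b.support) (c : ι → ℤ) : val b c i = c i := by
  classical
  simp [val, coord_of_mem_support b hi, hi]

lemma height_eq_sum_height {κ : Type*} {s : Finset κ} {a : κ → ℤ} {f : κ → ι} {γ : ι}
    (h : P.root γ = ∑ i ∈ s, a i • P.root (f i)) :
    b.height γ = ∑ i ∈ s, a i * b.height (f i) := by
  simp_rw [height_eq_val]
  exact val_eq_sum b 1 h

lemma root_neg_eq_sum (γ : ι) :
    P.root (P.reflectionPerm γ γ) = ∑ i ∈ {γ}, (-1 : ℤ) • P.root i := by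
  simp [P.root_reflectionPerm]

lemma coord_neg (γ j : ι) : coord b (P.reflectionPerm γ γ) j = -coord b γ j := by
  rw [coord_eq_sum b (f := id) (root_neg_eq_sum γ)]
  simp

lemma height_neg (γ : ι) : b.height (P.reflectionPerm γ γ) = -b.height γ := by
  rw [height_eq_sum_height b (f := id) (root_neg_eq_sum γ)]
  simp

lemma val_neg (c : ι → ℤ) (γ : ι) : val b c (P.reflectionPerm γ γ) = -val b c γ := by
  rw [val_eq_sum b (f := id) c (root_neg_eq_sum γ)]
  simp

lemma root_reflectionPerm_eq_sum [P.IsCrystallographic] (i γ : ι) :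
    P.root (P.reflectionPerm i γ) = ∑ x : Bool, (if x then 1 else -P.pairingIn ℤ γ i) •
      P.root (if x then γ else i) := by
  rw [P.root_reflectionPerm, P.reflection_apply_root' ℤ]
  simp [sub_eq_add_neg]

lemma val_reflectionPerm [P.IsCrystallographic] (c : ι → ℤ) (i γ : ι) :
    val b c (P.reflectionPerm i γ) = val b c γ - P.pairingIn ℤ γ i * val b c i := by
  rw [val_eq_sum b c (root_reflectionPerm_eq_sum i γ)]
  simp
  ring

lemma height_reflectionPerm [P.IsCrystallographic] (i γ : ι) :
    b.height (P.reflectionPerm i γ) = b.height γ - P.pairingIn ℤ γ i * b.height i := by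
  simp_rw [height_eq_val]
  exact val_reflectionPerm b 1 i γ

lemma root_eq_of_coord_eq {γ δ : ι} (h : ∀ j ∈ b.support, coord b γ j = coord b δ j) : γ = δ := by
  apply P.root.injective
  rw [root_eq_sum_coord b γ, root_eq_sum_coord b δ]
  exact Finset.sum_congr rfl fun j hj => by rw [h j hj]

lemma exists_nat_coeff_of_mem_closure {S : Finset ι} {x : M}
    (hx : x ∈ AddSubmonoid.closure (P.root '' (S : Set ι))) :
    ∃ f : ι → ℕ, x = ∑ j ∈ S, f j • P.root j := by
  classical
  induction hx using AddSubmonoid.closure_induction with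
  | mem x hx =>
    obtain ⟨j, hj, rfl⟩ := hx
    refine ⟨Pi.single j 1, ?_⟩
    simp only [Finset.mem_coe] at hj
    simp [Pi.single_apply, hj]
  | zero => exact ⟨0, by simp⟩
  | add x y _ _ hx hy =>
    obtain ⟨f, rfl⟩ := hx
    obtain ⟨g, rfl⟩ := hy
    exact ⟨f + g, by simp [add_smul, Finset.sum_add_distrib]⟩

variable {b}

lemma IsMaximalRoot.exists_coeff {S : Finset ι} (hS : S ⊆ b.support) {C : Set ι} {θ : ι}
    (hθ : IsMaximalRoot P (S : Set ι) C θ) {γ : ι} (hγ : γ ∈ C) :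
    ∃ f : ι → ℕ, (∀ j ∉ S, f j = 0) ∧ ∀ j, coord b θ j = coord b γ j + f j := by
  classical
  obtain ⟨f, hf⟩ := exists_nat_coeff_of_mem_closure (hθ.2 γ hγ)
  refine ⟨fun j => if j ∈ S then f j else 0, fun j hj => if_neg hj, fun j => ?_⟩
  by_cases hj : j ∈ b.support
  · refine coord_eq_of_root_eq b
      (f := fun j => coord b γ j + ((if j ∈ S then f j else 0 : ℕ) : ℤ)) ?_ j hj
    simp_rw [add_smul, Finset.sum_add_distrib, ← root_eq_sum_coord]
    rw [sub_eq_iff_eq_add'.mp hf]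
    congr 1
    simp only [natCast_zsmul, ite_smul, zero_smul]
    rw [Finset.sum_ite_mem, Finset.inter_eq_right.mpr hS]
  · have hj' : j ∉ S := fun h => hj (hS h)
    simp [coord_eq_zero b hj, hj']

end Coord

/-! ### The Weyl group on roots -/

section Weyl

lemma root_weyl_eq_sum (w : P.weylGroup) {κ : Type*} {s : Finset κ} {a : κ → ℤ} {f : κ → ι} {γ : ι}
    (h : P.root γ = ∑ i ∈ s, a i • P.root (f i)) :
    P.root (P.weylGroupToPerm w γ) = ∑ i ∈ s, a i • P.root (P.weylGroupToPerm w (f i)) := by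
  simp_rw [← P.weylGroup_apply_root, h, Finset.smul_sum, smul_comm w]

lemma weylGroupToPerm_neg (w : P.weylGroup) (γ : ι) :
    P.weylGroupToPerm w (P.reflectionPerm γ γ) =
      P.reflectionPerm (P.weylGroupToPerm w γ) (P.weylGroupToPerm w γ) := by
  apply P.root.injective
  rw [root_weyl_eq_sum w (f := id) (root_neg_eq_sum γ), root_neg_eq_sum]
  simp

lemma weylGroupToPerm_ofIdx (i γ : ι) :
    P.weylGroupToPerm (RootPairing.weylGroup.ofIdx P i) γ = P.reflectionPerm i γ := rfl

lemma root'_eq_sum {κ : Type*} {s : Finset κ} {a : κ → ℤ} {f : κ → ι} {γ : ι}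
    (h : P.root γ = ∑ i ∈ s, a i • P.root (f i)) (x : V) :
    P.root' γ x = ∑ i ∈ s, (a i : ℂ) * P.root' (f i) x := by
  simp [RootPairing.root', h, map_sum, LinearMap.sum_apply]

lemma root'_neg (γ : ι) (x : V) : P.root' (P.reflectionPerm γ γ) x = -P.root' γ x := by
  rw [root'_eq_sum (f := id) (root_neg_eq_sum γ)]
  simp

lemma root'_reflectionPerm (i γ : ι) (x : V) :
    P.root' (P.reflectionPerm i γ) x = P.root' γ x - P.pairing γ i * P.root' i x := by
  simp only [RootPairing.root', ← P.reflectionPerm_root, map_sub, map_smul, LinearMap.sub_apply,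
    LinearMap.smul_apply, smul_eq_mul]
  rfl

end Weyl

/-! ### Maximal roots -/

section Maximal

variable {b : P.Base} {S : Finset ι} {C : Set ι} {θ : ι}

lemma IsMaximalRoot.coord_le (hS : S ⊆ b.support) (hθ : IsMaximalRoot P (S : Set ι) C θ) {γ : ι}
    (hγ : γ ∈ C) (j : ι) : coord b γ j ≤ coord b θ j := by
  obtain ⟨f, -, hf⟩ := hθ.exists_coeff hS hγ
  rw [hf]
  omega

lemma IsMaximalRoot.neg_le_coord (hS : S ⊆ b.support) (hθ : IsMaximalRoot P (S : Set ι) C θ)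
    (hC : ∀ γ ∈ C, P.reflectionPerm γ γ ∈ C) {γ : ι} (hγ : γ ∈ C) (j : ι) :
    -coord b θ j ≤ coord b γ j := by
  have := hθ.coord_le hS (hC γ hγ) j
  rw [coord_neg] at this
  omega

lemma IsMaximalRoot.coord_nonneg (hS : S ⊆ b.support) (hθ : IsMaximalRoot P (S : Set ι) C θ)
    (hC : ∀ γ ∈ C, P.reflectionPerm γ γ ∈ C) (j : ι) : 0 ≤ coord b θ j := by
  have := hθ.neg_le_coord hS hC hθ.1 j
  omega

/-- Maximality compared with `-θ` makes `2θ` a combination of `S`, so `θ` has no coordinate outside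
`S`. Every other root of `C` is squeezed coordinatewise between `-θ` and `θ`. -/
lemma IsMaximalRoot.coord_eq_zero_of_notMem (hS : S ⊆ b.support)
    (hθ : IsMaximalRoot P (S : Set ι) C θ) (hC : ∀ γ ∈ C, P.reflectionPerm γ γ ∈ C) {γ : ι}
    (hγ : γ ∈ C) {j : ι} (hj : j ∉ S) : coord b γ j = 0 := by
  obtain ⟨f, hf0, hf⟩ := hθ.exists_coeff hS (hC θ hθ.1)
  have h1 := hf j
  rw [coord_neg, hf0 j hj] at h1
  have h2 := hθ.coord_le hS hγ j
  have h3 := hθ.neg_le_coord hS hC hγ j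
  push_cast at h1
  omega

lemma IsMaximalRoot.root_eq_sum (hS : S ⊆ b.support)
    (hθ : IsMaximalRoot P (S : Set ι) C θ) (hC : ∀ γ ∈ C, P.reflectionPerm γ γ ∈ C) {γ : ι}
    (hγ : γ ∈ C) : P.root γ = ∑ j ∈ S, coord b γ j • P.root j := by
  rw [root_eq_sum_coord b γ]
  refine (Finset.sum_subset hS fun j _ hj => ?_).symm
  rw [hθ.coord_eq_zero_of_notMem hS hC hγ hj, zero_smul]

lemma IsMaximalRoot.height_le (hS : S ⊆ b.support) (hθ : IsMaximalRoot P (S : Set ι) C θ) {γ : ι}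
    (hγ : γ ∈ C) : b.height γ ≤ b.height θ := by
  simp_rw [height_eq_val, val]
  simpa using Finset.sum_le_sum fun j _ => hθ.coord_le hS hγ j

lemma IsMaximalRoot.neg_height_le (hS : S ⊆ b.support) (hθ : IsMaximalRoot P (S : Set ι) C θ)
    (hC : ∀ γ ∈ C, P.reflectionPerm γ γ ∈ C) {γ : ι} (hγ : γ ∈ C) :
    -b.height θ ≤ b.height γ := by
  have := hθ.height_le hS (hC γ hγ)
  rw [height_neg] at this
  omega

lemma IsMaximalRoot.eq_of_height_eq (hS : S ⊆ b.support) (hθ : IsMaximalRoot P (S : Set ι) C θ)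
    {γ : ι} (hγ : γ ∈ C) (h : b.height γ = b.height θ) : γ = θ := by
  simp_rw [height_eq_val, val] at h
  refine root_eq_of_coord_eq b fun j hj => ?_
  have := (Finset.sum_eq_sum_iff_of_le (fun j _ => by
    simpa using hθ.coord_le hS hγ j)).mp h j hj
  simpa using this

lemma IsMaximalRoot.height_pos (hS : S ⊆ b.support) (hθ : IsMaximalRoot P (S : Set ι) C θ)
    (hC : ∀ γ ∈ C, P.reflectionPerm γ γ ∈ C) : 0 < b.height θ := by
  have h1 := hθ.neg_height_le hS hC hθ.1
  have h2 := b.height_ne_zero θ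
  omega

end Maximal

/-! ### Components of the subsystem -/

section Components

variable {S₀ : Finset ι}

lemma mem_compSimple {l : Component P S₀} {i : ι} :
    i ∈ compSimple l ↔ i ∈ S₀ ∧ i ∈ compRoots l := by
  classical
  simp [compSimple]

lemma subset_subRoots {i : ι} (hi : i ∈ S₀) : i ∈ subRoots P S₀ :=
  Submodule.subset_span ⟨i, hi, rfl⟩

lemma exists_mem_compRoots {γ : ι} (h : γ ∈ subRoots P S₀) :
    ∃ l : Component P S₀, γ ∈ compRoots l := ⟨_, h, rfl⟩

lemma mem_compRoots_of_pairing_ne_zero {l : Component P S₀} {γ δ : ι} (hγ : γ ∈ compRoots l)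
    (hδ : δ ∈ subRoots P S₀) (h : P.pairing γ δ ≠ 0) : δ ∈ compRoots l := by
  obtain ⟨hγ, rfl⟩ := hγ
  exact ⟨hδ, (Quot.sound (show NonOrthogonal P S₀ ⟨γ, hγ⟩ ⟨δ, hδ⟩ from h)).symm⟩

lemma reflectionPerm_mem_subRoots {i γ : ι} (hi : i ∈ subRoots P S₀) (hγ : γ ∈ subRoots P S₀) :
    P.reflectionPerm i γ ∈ subRoots P S₀ := by
  rw [subRoots, Set.mem_ofPred_eq, P.root_reflectionPerm, P.reflection_apply]
  exact sub_mem hγ (Submodule.smul_mem _ _ hi)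

lemma neg_mem_compRoots {l : Component P S₀} {γ : ι} (hγ : γ ∈ compRoots l) :
    P.reflectionPerm γ γ ∈ compRoots l := by
  refine mem_compRoots_of_pairing_ne_zero hγ (reflectionPerm_mem_subRoots hγ.1 hγ.1) ?_
  rw [P.pairing_reflectionPerm_self_right, P.pairing_same]
  norm_num

lemma reflectionPerm_mem_compRoots {l : Component P S₀} {i γ : ι} (hi : i ∈ subRoots P S₀)
    (hγ : γ ∈ compRoots l) : P.reflectionPerm i γ ∈ compRoots l := by
  by_cases h : P.pairing γ i = 0
  · convert hγ
    apply P.root.injective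
    rw [← P.reflectionPerm_root]
    have : P.toLinearMap (P.root γ) (P.coroot i) = 0 := h
    simp [this]
  · refine mem_compRoots_of_pairing_ne_zero (mem_compRoots_of_pairing_ne_zero hγ hi h)
      (reflectionPerm_mem_subRoots hi hγ.1) ?_
    rw [Ne, P.pairing_eq_zero_iff', ← P.pairing_reflectionPerm, P.pairing_reflectionPerm_self_right,
      neg_eq_zero]
    exact h

variable {b : P.Base} (hS₀ : S₀ ⊆ b.support)
include hS₀

lemma compSimple_subset (l : Component P S₀) : compSimple l ⊆ b.support :=
  fun _ h => hS₀ (mem_compSimple.mp h).1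

variable {l : Component P S₀} {θ : ι} (hθ : IsMaximalRoot P (compSimple l : Set ι) (compRoots l) θ)
include hθ

lemma coord_maximal_pos {j : ι} (hj : j ∈ compSimple l) : 0 < coord b θ j := by
  classical
  have := hθ.coord_le (compSimple_subset hS₀ l) (mem_compSimple.mp hj).2 j
  rw [coord_of_mem_support b (compSimple_subset hS₀ l hj), if_pos rfl] at this
  omega

lemma comp_root_eq_sum {γ : ι} (hγ : γ ∈ compRoots l) :
    P.root γ = ∑ j ∈ compSimple l, coord b γ j • P.root j :=
  hθ.root_eq_sum (compSimple_subset hS₀ l) (fun _ => neg_mem_compRoots) hγ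

end Components

/-! ### Positive affine roots -/

section AffPos

variable (b : P.Base) (θ : ι)

/-- The affine root `[γ, ℏ k]` is positive. Its affine height is `ht γ + (ht θ + 1) k`, where `θ` is
the maximal root. -/
def AffPos (γ : ι) (k : ℤ) : Prop := 0 < b.height γ + (b.height θ + 1) * k

variable {b θ}

lemma neg_mem_univ (γ : ι) (_ : γ ∈ (Set.univ : Set ι)) :
    P.reflectionPerm γ γ ∈ (Set.univ : Set ι) := Set.mem_univ _

lemma affineHeight_node (j : Node b) :
    b.height (nodeRoot b θ j) + (b.height θ + 1) * nodeLevel b j = 1 := by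
  cases j with
  | none => simp [nodeRoot, nodeLevel, height_neg]
  | some i => simp [nodeRoot, nodeLevel, b.height_one_of_mem_support i.2]

variable (hθ : IsMaximalRoot P (b.support : Set ι) Set.univ θ)
include hθ

lemma height_le_maximal (γ : ι) : b.height γ ≤ b.height θ :=
  hθ.height_le subset_rfl (Set.mem_univ γ)

lemma neg_height_le_maximal (γ : ι) : -b.height θ ≤ b.height γ :=
  hθ.neg_height_le subset_rfl neg_mem_univ (Set.mem_univ γ)

lemma height_maximal_pos : 0 < b.height θ :=
  hθ.height_pos subset_rfl neg_mem_univ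

/-- Since `|ht γ| ≤ ht θ`, the term `(ht θ + 1) k` decides the sign as soon as `k ≠ 0`. This
recovers the usual notion of positivity. -/
lemma affPos_iff {γ : ι} {k : ℤ} : AffPos b θ γ k ↔ 0 < k ∨ k = 0 ∧ b.IsPos γ := by
  have h1 := height_le_maximal hθ γ
  have h2 := neg_height_le_maximal hθ γ
  rw [RootPairing.Base.isPos_iff, AffPos]
  rcases lt_trichotomy k 0 with h | h | h
  · constructor
    · intro h'
      nlinarith
    · omega
  · simp [h]
  · simp only [h, true_or, iff_true]
    nlinarith

lemma nonneg_of_affPos {γ : ι} {k : ℤ} (h : AffPos b θ γ k) : 0 ≤ k := by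
  rcases (affPos_iff hθ).mp h with h | h <;> omega

lemma affineHeight_ne_zero (γ : ι) (k : ℤ) : b.height γ + (b.height θ + 1) * k ≠ 0 := by
  have h1 := height_le_maximal hθ γ
  have h2 := neg_height_le_maximal hθ γ
  have h3 := b.height_ne_zero γ
  rcases lt_trichotomy k 0 with h | h | h
  · nlinarith
  · simpa [h] using h3
  · nlinarith

/-- The affine analogue of the fact that a simple reflection permutes the positive roots other than
its own. For the node `0` it is checked by affine heights. -/
lemma affPos_reflection [P.IsCrystallographic] [P.IsReduced] [Finite ι] (j : Node b) {γ : ι} {k : ℤ}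
    (h : AffPos b θ γ k) (hne : ¬ (γ = nodeRoot b θ j ∧ k = nodeLevel b j)) :
    AffPos b θ (P.reflectionPerm (nodeRoot b θ j) γ)
      (k - P.pairingIn ℤ γ (nodeRoot b θ j) * nodeLevel b j) := by
  cases j with
  | some i =>
    simp only [nodeRoot, nodeLevel, mul_zero, sub_zero] at hne ⊢
    rcases (affPos_iff hθ).mp h with h | ⟨rfl, hγ⟩
    · exact (affPos_iff hθ).mpr (Or.inl h)
    · exact (affPos_iff hθ).mpr (Or.inr ⟨rfl, hγ.reflectionPerm i.2 fun e => hne ⟨e, rfl⟩⟩)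
  | none =>
    have h0 := affineHeight_ne_zero hθ (P.reflectionPerm (nodeRoot b θ none) γ)
      (k - P.pairingIn ℤ γ (nodeRoot b θ none) * nodeLevel b none)
    have h1 := height_le_maximal hθ (P.reflectionPerm (nodeRoot b θ none) γ)
    have h2 := neg_height_le_maximal hθ γ
    have h4 := height_maximal_pos hθ
    have h3 := nonneg_of_affPos hθ h
    rw [AffPos] at h ⊢
    rw [height_reflectionPerm] at *
    simp only [nodeRoot, nodeLevel, height_neg, mul_one] at *
    set p := P.pairingIn ℤ γ (P.reflectionPerm θ θ)
    -- The reflected gradient has height `ht γ + p ht θ ≤ ht θ`, while `ht γ ≥ -ht θ`.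
    have hp : p ≤ 2 := by
      by_contra hp
      nlinarith
    rcases eq_or_lt_of_le hp with hp | hp
    · have h5 : b.height γ = -b.height θ := by
        rw [hp] at h1
        omega
      have h6 : γ = P.reflectionPerm θ θ := by
        have := hθ.eq_of_height_eq subset_rfl (Set.mem_univ (P.reflectionPerm γ γ))
          (by rw [height_neg, h5]; ring)
        rw [← this]
        let _ := P.indexNeg
        exact (neg_neg γ).symm
      have h7 : k ≠ 1 := fun hk => hne ⟨h6, hk⟩
      have h8 : k ≠ 0 := by
        rintro rfl
        omega
      have h9 : 2 ≤ k := by omega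
      rw [hp, h5]
      nlinarith
    -- The affine height drops by `p ≤ 1` from a value at least one, and an affine height is never
    -- zero.
    · have : (b.height γ - p * -b.height θ) + (b.height θ + 1) * (k - p) =
        b.height γ + (b.height θ + 1) * k - p := by ring
      omega

end AffPos

/-! ### Conjugating the parts of an extended base into the base -/

section Rotation

lemma exists_unique_term_of_sum_mul_eq_one {κ : Type*} {S : Finset κ} {a v : κ → ℤ}
    (ha : ∀ j ∈ S, 0 ≤ a j) (hv : ∀ j ∈ S, 1 ≤ v j) (h : ∑ j ∈ S, a j * v j = 1) :
    ∃ j ∈ S, a j = 1 ∧ v j = 1 ∧ ∀ k ∈ S, k ≠ j → a k = 0 := by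
  classical
  obtain ⟨j, hj, hne⟩ := Finset.exists_ne_zero_of_sum_ne_zero (h.trans_ne one_ne_zero)
  have h0 : ∀ k ∈ S.erase j, 0 ≤ a k * v k := fun k hk =>
    mul_nonneg (ha k (Finset.mem_of_mem_erase hk))
      (zero_le_one.trans (hv k (Finset.mem_of_mem_erase hk)))
  have h1 := Finset.sum_nonneg h0
  have h2 : a j * v j + ∑ k ∈ S.erase j, a k * v k = 1 :=
    (Finset.add_sum_erase S (fun k => a k * v k) hj).trans h
  have h3 : 1 ≤ a j := by
    have := ha j hj
    have : a j ≠ 0 := left_ne_zero_of_mul hne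
    omega
  have h4 := hv j hj
  have h5 : a j * v j = 1 := by
    have : 1 ≤ a j * v j := by nlinarith
    omega
  have h6 : ∑ k ∈ S.erase j, a k * v k = 0 := by
    omega
  refine ⟨j, hj, by nlinarith, by nlinarith, fun k hk hkj => ?_⟩
  have h7 := (Finset.sum_eq_zero_iff_of_nonneg h0).mp h6 k (Finset.mem_erase.mpr ⟨hkj, hk⟩)
  have := hv k hk
  rcases mul_eq_zero.mp h7 with h | h
  · exact h
  · omega

variable {S₀ : Finset ι} {b : P.Base}

/-- The reflection in `α` permutes the positive roots other than `α`, so only the term of `α`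
changes, and it changes sign. -/
lemma sum_pos_reflection [Fintype ι] [P.IsCrystallographic] [P.IsReduced] {α : ι}
    (hα : α ∈ b.support) (φ : ι → ℤ) (hφ : ∀ γ, φ (P.reflectionPerm γ γ) = -φ γ) :
    open Classical in
    ∑ γ with b.IsPos γ, φ (P.reflectionPerm α γ) = ∑ γ with b.IsPos γ, φ γ - 2 * φ α := by
  classical
  have hm : α ∈ Finset.univ.filter b.IsPos := by
    simpa using RootPairing.Base.isPos_of_mem_support hα
  rw [← Finset.add_sum_erase _ _ hm, ← Finset.add_sum_erase _ _ hm, hφ]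
  have hmap : ∀ γ ∈ (Finset.univ.filter b.IsPos).erase α,
      P.reflectionPerm α γ ∈ (Finset.univ.filter b.IsPos).erase α := by
    intro γ hγ
    simp only [Finset.mem_erase, Finset.mem_filter, Finset.mem_univ, true_and] at hγ ⊢
    refine ⟨fun h => ?_, hγ.2.reflectionPerm hα hγ.1⟩
    have h1 : γ = P.reflectionPerm α α := by
      rw [← P.reflectionPerm_self α γ, h]
    have h2 := hγ.2
    have h3 := RootPairing.Base.isPos_of_mem_support hα
    rw [RootPairing.Base.isPos_iff] at h2 h3
    rw [h1, height_neg] at h2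
    omega
  have : ∑ γ ∈ (Finset.univ.filter b.IsPos).erase α, φ (P.reflectionPerm α γ) =
      ∑ γ ∈ (Finset.univ.filter b.IsPos).erase α, φ γ :=
    Finset.sum_bij' (fun γ _ => P.reflectionPerm α γ) (fun γ _ => P.reflectionPerm α γ) hmap hmap
      (fun _ _ => P.reflectionPerm_self _ _) (fun _ _ => P.reflectionPerm_self _ _)
      (fun _ _ => rfl)
  rw [this]
  ring

/-- Among the Weyl elements preserving all components, take one maximizing the sum of `val b c` over
the images of the positive roots. Composing with the reflection in `α ∈ S₀` changes this sum by `-2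
val b c (u α)`, so that value is non-negative. It is non-zero by assumption. -/
lemma exists_weyl_val_pos [Finite ι] [P.IsCrystallographic] [P.IsReduced]
    (hS₀ : S₀ ⊆ b.support) (c : ι → ℤ)
    (hc : ∀ γ ∈ subRoots P S₀, val b c γ ≠ 0) :
    ∃ u : P.weylGroup, (∀ l : Component P S₀, ∀ γ, P.weylGroupToPerm u γ ∈ compRoots l ↔
      γ ∈ compRoots l) ∧ ∀ α ∈ S₀, 0 < val b c (P.weylGroupToPerm u α) := by
  classical
  have := Fintype.ofFinite ι
  let A : Set (Equiv.Perm ι) := {p | (∃ u : P.weylGroup, P.weylGroupToPerm u = p) ∧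
    ∀ l : Component P S₀, ∀ γ, p γ ∈ compRoots l ↔ γ ∈ compRoots l}
  obtain ⟨p, ⟨⟨u, rfl⟩, hu⟩, hmax⟩ := Set.exists_max_image A
    (fun p => ∑ γ with b.IsPos γ, val b c (p γ)) (Set.toFinite A)
    ⟨1, ⟨1, map_one P.weylGroupToPerm⟩, fun l γ => Iff.rfl⟩
  refine ⟨u, hu, fun α hα => ?_⟩
  have hs : ∀ (l : Component P S₀) γ, P.weylGroupToPerm (u * RootPairing.weylGroup.ofIdx P α) γ ∈
      compRoots l ↔ γ ∈ compRoots l := by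
    intro l γ
    rw [map_mul, Equiv.Perm.mul_apply, hu, weylGroupToPerm_ofIdx]
    refine ⟨fun h => ?_, fun h => reflectionPerm_mem_compRoots (subset_subRoots hα) h⟩
    rw [← P.reflectionPerm_self α γ]
    exact reflectionPerm_mem_compRoots (subset_subRoots hα) h
  have h1 := hmax _ ⟨⟨_, rfl⟩, hs⟩
  simp only [map_mul, Equiv.Perm.mul_apply, weylGroupToPerm_ofIdx] at h1
  rw [sum_pos_reflection (hS₀ hα) (fun γ => val b c (P.weylGroupToPerm u γ))
    (fun γ => by rw [weylGroupToPerm_neg, val_neg])] at h1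
  obtain ⟨l, hl⟩ := exists_mem_compRoots (subset_subRoots (P := P) hα)
  have h2 := hc _ ((hu l α).mpr hl).1
  omega

open Classical in
/-- The simple roots of a component, together with the negative of its maximal root. -/
noncomputable def extSimple (θ' : Component P S₀ → ι) (l : Component P S₀) : Finset ι :=
  insert (P.reflectionPerm (θ' l) (θ' l)) (compSimple l)

lemma mem_extSimple {θ' : Component P S₀ → ι} {l : Component P S₀} {i : ι} :
    i ∈ extSimple θ' l ↔ i = P.reflectionPerm (θ' l) (θ' l) ∨ i ∈ compSimple l := by
  classical
  simp [extSimple]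

lemma extSimple_subset_compRoots {θ' : Component P S₀ → ι}
    (hθ' : ∀ l, IsMaximalRoot P (compSimple l : Set ι) (compRoots l) (θ' l)) (l : Component P S₀) {i : ι} (hi : i ∈ extSimple θ' l) :
    i ∈ compRoots l := by
  rcases mem_extSimple.mp hi with rfl | hi
  · exact neg_mem_compRoots (hθ' l).1
  · exact (mem_compSimple.mp hi).2

variable (hS₀ : S₀ ⊆ b.support) {θ' : Component P S₀ → ι}
  (hθ' : ∀ l, IsMaximalRoot P (compSimple l : Set ι) (compRoots l) (θ' l))
include hS₀ hθ'

lemma neg_maximal_notMem (l : Component P S₀) :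
    P.reflectionPerm (θ' l) (θ' l) ∉ compSimple l := by
  intro h
  have h1 := b.height_one_of_mem_support (compSimple_subset hS₀ l h)
  have h2 := (hθ' l).height_pos (compSimple_subset hS₀ l) (fun _ => neg_mem_compRoots)
  rw [height_neg] at h1
  omega

lemma comp_height_eq_sum {l : Component P S₀} {γ : ι} (hγ : γ ∈ compRoots l) :
    b.height γ = ∑ j ∈ compSimple l, coord b γ j := by
  rw [height_eq_sum_height b (f := id) (comp_root_eq_sum hS₀ (hθ' l) hγ)]
  refine Finset.sum_congr rfl fun j hj => ?_
  rw [id, b.height_one_of_mem_support (compSimple_subset hS₀ l hj), mul_one]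

/-- If each component has a distinguished element of its extended base, of coefficient one, then the
other elements of the extended bases form a conjugate of the base. -/
lemma exists_weyl_image_eq_erase [Finite ι] [P.IsCrystallographic] [P.IsReduced]
    (i : Component P S₀ → ι)
    (hi : ∀ l, i l ∈ extSimple θ' l)
    (hi1 : ∀ l, i l ∈ compSimple l → coord b (θ' l) (i l) = 1) :
    ∃ u : P.weylGroup, ∀ l, ∀ α ∈ compSimple l, P.weylGroupToPerm u α ∈ extSimple θ' l ∧
      P.weylGroupToPerm u α ≠ i l := by
  classical
  -- This functional is chosen to equal one on the extended base without `i l`: if a simple node is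
  -- removed, the value `-ht θ'` there gives `-θ'` the value `-ht θ' + (ht θ' + 1) = 1`. On a root
  -- it is `ht γ - (ht θ' + 1) coord γ (i l)`, or `ht γ` if `-θ'` is removed. It never vanishes on
  -- the subsystem.
  set c : ι → ℤ := fun j => if h : j ∈ subRoots P S₀ then
    (if i (Quot.mk _ ⟨j, h⟩) = j then -b.height (θ' (Quot.mk _ ⟨j, h⟩)) else 1) else 1 with hcdef
  have hc : ∀ l, ∀ j ∈ compSimple l, c j = if i l = j then -b.height (θ' l) else 1 := by
    intro l j hj
    obtain ⟨h, rfl⟩ := (mem_compSimple.mp hj).2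
    simp [hcdef, h]
  have hval : ∀ l, ∀ γ ∈ compRoots l, val b c γ = b.height γ -
      if i l ∈ compSimple l then (b.height (θ' l) + 1) * coord b γ (i l) else 0 := by
    intro l γ hγ
    rw [val_eq_sum b c (f := id) (comp_root_eq_sum hS₀ (hθ' l) hγ),
      comp_height_eq_sum hS₀ hθ' hγ,
      ← Finset.sum_ite_eq (compSimple l) (i l) (fun j => (b.height (θ' l) + 1) * coord b γ j),
      ← Finset.sum_sub_distrib]
    refine Finset.sum_congr rfl fun j hj => ?_
    rw [id, val_of_mem_support b (compSimple_subset hS₀ l hj), hc l j hj]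
    split_ifs <;> ring
  have hne : ∀ γ ∈ subRoots P S₀, val b c γ ≠ 0 := by
    intro γ hγ
    obtain ⟨l, hl⟩ := exists_mem_compRoots hγ
    have h1 := (hθ' l).height_le (compSimple_subset hS₀ l) hl
    have h2 := (hθ' l).neg_height_le (compSimple_subset hS₀ l) (fun _ => neg_mem_compRoots) hl
    have h3 := b.height_ne_zero γ
    rw [hval l γ hl]
    split_ifs
    · rcases lt_trichotomy (coord b γ (i l)) 0 with h | h | h
      · nlinarith
      · simpa [h] using h3
      · nlinarith
    · simpa using h3
  obtain ⟨u, hu, hpos⟩ := exists_weyl_val_pos hS₀ c hne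
  have hone : ∀ l, ∀ σ ∈ (extSimple θ' l).erase (i l), val b c σ = 1 := by
    intro l σ hσ
    obtain ⟨hσi, hσ⟩ := Finset.mem_erase.mp hσ
    rw [hval l σ (extSimple_subset_compRoots hθ' l hσ)]
    rcases mem_extSimple.mp hσ with rfl | hσ
    · have h1 : i l ∈ compSimple l := (mem_extSimple.mp (hi l)).resolve_left (Ne.symm hσi)
      rw [if_pos h1, height_neg, coord_neg, hi1 l h1]
      ring
    · rw [b.height_one_of_mem_support (compSimple_subset hS₀ l hσ),
        coord_of_mem_support b (compSimple_subset hS₀ l hσ), if_neg (Ne.symm hσi)]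
      simp
  -- A root of value one is indecomposable: its coefficients in `u S_ℓ` have one sign and all
  -- elements of `u S_ℓ` have values at least one, so it lies in `u S_ℓ`. Comparing cardinalities
  -- turns the inclusion into an equality.
  have hsub : ∀ l, (extSimple θ' l).erase (i l) ⊆
      (compSimple l).image (P.weylGroupToPerm u) := by
    intro l σ hσ
    set γ := (P.weylGroupToPerm u).symm σ with hγdef
    have hσγ : P.weylGroupToPerm u γ = σ := Equiv.apply_symm_apply _ _
    have hγ : γ ∈ compRoots l := by
      rw [← hu, hσγ]
      exact extSimple_subset_compRoots hθ' l (Finset.mem_of_mem_erase hσ)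
    have hr := comp_root_eq_sum hS₀ (hθ' l) hγ
    have h1 := hone l σ hσ
    rw [← hσγ, val_eq_sum b c (root_weyl_eq_sum u (f := id) hr)] at h1
    have hv : ∀ j ∈ compSimple l, 1 ≤ val b c (P.weylGroupToPerm u j) := fun j hj =>
      hpos j (mem_compSimple.mp hj).1
    have hnn : ∀ j ∈ compSimple l, 0 ≤ coord b γ j := by
      rcases coord_nonneg_or_nonpos b γ with h | h
      · exact fun j _ => h j
      · exfalso
        have : ∑ j ∈ compSimple l, coord b γ j * val b c (P.weylGroupToPerm u (id j)) ≤ 0 :=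
          Finset.sum_nonpos fun j hj =>
            mul_nonpos_of_nonpos_of_nonneg (h j) (zero_le_one.trans (hv j hj))
        omega
    obtain ⟨j, hj, hj1, -, hj0⟩ := exists_unique_term_of_sum_mul_eq_one hnn hv h1
    refine Finset.mem_image.mpr ⟨j, hj, ?_⟩
    rw [← hσγ]
    congr 1
    apply P.root.injective
    rw [hr, Finset.sum_eq_single j (fun k hk hkj => by rw [hj0 k hk hkj, zero_smul])
      (fun h => absurd hj h), hj1, one_smul]
  refine ⟨u, fun l α hα => ?_⟩
  have hcard : ((compSimple l).image (P.weylGroupToPerm u)).card ≤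
      ((extSimple θ' l).erase (i l)).card := by
    rw [Finset.card_erase_of_mem (hi l), extSimple,
      Finset.card_insert_of_notMem (neg_maximal_notMem hS₀ hθ' l), Nat.add_sub_cancel]
    exact Finset.card_image_le
  have h := Finset.mem_image_of_mem (P.weylGroupToPerm u) hα
  rw [← Finset.eq_of_subset_of_card_le (hsub l) hcard, Finset.mem_erase] at h
  exact ⟨h.2, h.1⟩

end Rotation

/-! ### Components of type `A` -/

section TypeA

/-- The label at `p = q` is a dummy value that every clause avoids. Pairings are stated as casts of
integers so that equations between them can be settled in `ℤ`. -/
lemma IsTypeA.exists_labelling [Nonempty ι] {C : Set ι} {k : ℕ} (h : IsTypeA P C k) :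
    ∃ E : Fin (k + 1) → Fin (k + 1) → ι, (∀ p q, p ≠ q → E p q ∈ C) ∧
      (∀ i ∈ C, ∃ p q, p ≠ q ∧ E p q = i) ∧
      ∀ p q r s, p ≠ q → r ≠ s → P.pairing (E p q) (E r s) =
        (((if p = r then 1 else 0) - (if q = r then 1 else 0) - (if p = s then 1 else 0) +
          (if q = s then 1 else 0) : ℤ) : ℂ) := by
  classical
  obtain ⟨e, he⟩ := h
  refine ⟨fun p q => if h : p ≠ q then (e.symm ⟨(p, q), h⟩).1 else Classical.arbitrary ι, ?_, ?_, ?_⟩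
  · intro p q h
    simp only [h, ne_eq, not_false_eq_true, dite_true]
    exact (e.symm _).2
  · intro i hi
    refine ⟨(e ⟨i, hi⟩).1.1, (e ⟨i, hi⟩).1.2, (e ⟨i, hi⟩).2, ?_⟩
    simp only [dif_pos (e ⟨i, hi⟩).2]
    simp
  · intro p q r s h h'
    simp only [dif_pos h, dif_pos h', he]
    simp only [Equiv.apply_symm_apply, dotProduct_sub, dotProduct_single, Pi.sub_apply,
      Pi.single_apply, mul_one]
    push_cast
    simp only [eq_comm (a := r), eq_comm (a := s)]
    ring

lemma root_reflectionPerm_of_pairing {i j : ι} {z : ℤ} (h : P.pairing j i = z) :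
    P.root (P.reflectionPerm i j) = P.root j - z • P.root i := by
  rw [← P.reflectionPerm_root]
  have : P.toLinearMap (P.root j) (P.coroot i) = z := h
  rw [this, Int.cast_smul_eq_zsmul]

/-- For pairing `±1`, the product `s_i s_j` sends `α_i` to `∓α_j`; for pairing `±2`, the roots are
equal or opposite. In each case they are conjugate. -/
lemma eq_of_invariant_of_pairing_eq [Finite ι] {η : ι → ℂ} (hη : ∀ i j, η (P.reflectionPerm i j) = η j)
    {i j : ι} {z : ℤ} (h : P.pairing i j = z) (h' : P.pairing j i = z)
    (hz : z = 1 ∨ z = -1 ∨ z = 2 ∨ z = -2) : η i = η j := by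
  rcases hz with rfl | rfl | rfl | rfl
  · have h1 : P.reflectionPerm i (P.reflectionPerm j i) = P.reflectionPerm j j := by
      apply P.root.injective
      rw [P.root_reflectionPerm, root_reflectionPerm_of_pairing h, map_sub, map_zsmul,
        P.reflection_apply_self, ← P.root_reflectionPerm, root_reflectionPerm_of_pairing h',
        P.root_reflectionPerm, P.reflection_apply_self]
      module
    rw [← hη j i, ← hη i (P.reflectionPerm j i), h1, hη]
  · have h1 : P.reflectionPerm i (P.reflectionPerm j i) = j := by
      apply P.root.injective
      rw [P.root_reflectionPerm, root_reflectionPerm_of_pairing h, map_sub, map_zsmul,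
        P.reflection_apply_self, ← P.root_reflectionPerm, root_reflectionPerm_of_pairing h']
      module
    rw [← hη j i, ← hη i (P.reflectionPerm j i), h1]
  · have : i = j := by
      have := (P.pairing_two_two_iff i j).mp ⟨by simpa using h, by simpa using h'⟩
      exact this
    rw [this]
  · have h1 := (P.pairing_neg_two_neg_two_iff i j).mp ⟨by simpa using h, by simpa using h'⟩
    have h2 : i = P.reflectionPerm j j := by
      apply P.root.injective
      rw [h1, P.root_reflectionPerm, P.reflection_apply_self]
    rw [h2, hη]

/-- Type `A` is simply laced, so non-orthogonal roots are conjugate, and a component is connected by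
chains of non-orthogonal roots. -/
lemma IsTypeA.eq_of_invariant [Finite ι] {S₀ : Finset ι} {l : Component P S₀} {k : ℕ}
    (h : IsTypeA P (compRoots l) k) {η : ι → ℂ} (hη : ∀ i j, η (P.reflectionPerm i j) = η j)
    {γ δ : ι} (hγ : γ ∈ compRoots l) (hδ : δ ∈ compRoots l) : η γ = η δ := by
  have : Nonempty ι := ⟨γ⟩
  obtain ⟨E, hE, hE', hp⟩ := h.exists_labelling
  have step : ∀ i ∈ compRoots l, ∀ j ∈ compRoots l, P.pairing i j ≠ 0 → η i = η j := by
    intro i hi j hj hij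
    obtain ⟨p, q, hpq, rfl⟩ := hE' i hi
    obtain ⟨r, s, hrs, rfl⟩ := hE' j hj
    have h1 := hp p q r s hpq hrs
    have h2 := hp r s p q hrs hpq
    refine eq_of_invariant_of_pairing_eq hη h1 (h2.trans ?_) ?_
    · simp only [eq_comm (a := r), eq_comm (a := s)]
      congr 1
      ring
    · rw [h1] at hij
      have hij' := Int.cast_ne_zero.mp hij
      clear h1 h2 hij
      split_ifs at hij' ⊢ <;> simp_all
  have key : ∀ a c : subRoots P S₀, Relation.EqvGen (NonOrthogonal P S₀) a c →
      a.1 ∈ compRoots l → η a = η c := by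
    intro a c hac
    induction hac with
    | rel a c hr =>
      intro ha
      exact step _ ha _ (mem_compRoots_of_pairing_ne_zero ha c.2 hr) hr
    | refl a => exact fun _ => rfl
    | symm a c hac ih =>
      intro hc
      refine (ih ?_).symm
      obtain ⟨_, rfl⟩ := hc
      exact ⟨a.2, Quot.eqvGen_sound hac⟩
    | trans a c d hac _ ih ih' =>
      intro ha
      refine (ih ha).trans (ih' ?_)
      obtain ⟨_, rfl⟩ := ha
      exact ⟨c.2, (Quot.eqvGen_sound hac).symm⟩
  obtain ⟨hγ', rfl⟩ := id hγ
  obtain ⟨hδ', hδl⟩ := hδ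
  exact key ⟨γ, hγ'⟩ ⟨δ, hδ'⟩ (Quot.eqvGen_exact hδl.symm) hγ

/-- The labelling knows only pairings and need not match the given base, so the additive structure
is first recovered. The `i`-th coordinate of `ε_p - ε_q` is then a difference `c p - c q`, and an
indicator function of a level set of `c` isolates the coefficient of the `i`-th simple root in `θ`.
-/
lemma IsTypeA.coord_maximal {S₀ : Finset ι} {b : P.Base} (hS₀ : S₀ ⊆ b.support)
    {l : Component P S₀} {k : ℕ} (h : IsTypeA P (compRoots l) k) {θ : ι}
    (hθ : IsMaximalRoot P (compSimple l : Set ι) (compRoots l) θ) {i : ι} (hi : i ∈ compSimple l) :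
    coord b θ i = 1 := by
  classical
  have : Nonempty ι := ⟨θ⟩
  obtain ⟨E, hE, hE', hp⟩ := h.exists_labelling
  -- Pairing two singles out the root itself, so sums and negatives can be identified through
  -- pairings alone.
  have huniq : ∀ δ ∈ compRoots l, ∀ p q, p ≠ q → P.pairing δ (E p q) = 2 → δ = E p q := by
    intro δ hδ p q hpq h2
    obtain ⟨r, s, hrs, rfl⟩ := hE' δ hδ
    rw [hp r s p q hrs hpq] at h2
    have h3 : ((if r = p then 1 else 0) - (if s = p then 1 else 0) - (if r = q then 1 else 0) +
          (if s = q then 1 else 0) : ℤ) = 2 := by exact_mod_cast h2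
    have h4 : r = p ∧ s = q := by
      split_ifs at h3 <;> simp_all
    rw [h4.1, h4.2]
  have hadd : ∀ p q r, p ≠ q → q ≠ r → p ≠ r →
      P.root (E p r) = P.root (E p q) + P.root (E q r) := by
    intro p q r hpq hqr hpr
    have h1 : P.pairing (E p q) (E q r) = ((-1 : ℤ) : ℂ) := by
      rw [hp _ _ _ _ hpq hqr]
      simp [hpq, hqr, hpr]
    have h2 := root_reflectionPerm_of_pairing h1
    have h3 : P.reflectionPerm (E q r) (E p q) = E p r := by
      refine huniq _ (reflectionPerm_mem_compRoots (hE q r hqr).1 (hE p q hpq)) p r hpr ?_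
      rw [RootPairing.pairing, RootPairing.root', h2]
      simp only [neg_smul, one_smul, sub_neg_eq_add,
        map_add, LinearMap.add_apply, P.root_coroot_eq_pairing]
      rw [hp _ _ _ _ hpq hpr, hp _ _ _ _ hqr hpr]
      simp [hqr, hpr, hpq.symm, hpr.symm]
      norm_num
    rw [← h3, h2]
    module
  have hneg : ∀ p q, p ≠ q → P.root (E q p) = -P.root (E p q) := by
    intro p q hpq
    have h3 : P.reflectionPerm (E p q) (E p q) = E q p := by
      refine huniq _ (neg_mem_compRoots (hE p q hpq)) q p hpq.symm ?_
      rw [P.pairing_reflectionPerm_self_left, hp _ _ _ _ hpq hpq.symm]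
      simp [hpq, hpq.symm]
    rw [← h3, P.root_reflectionPerm, P.reflection_apply_self]
  -- a potential for the coefficient of the `i`-th simple root
  have hcoord_add : ∀ p q r, p ≠ q → q ≠ r → p ≠ r →
      coord b (E p r) i = coord b (E p q) i + coord b (E q r) i := by
    intro p q r hpq hqr hpr
    rw [coord_eq_sum b (s := Finset.univ) (a := fun _ : Bool => 1)
      (f := fun x => if x then E p q else E q r) (by simp [hadd p q r hpq hqr hpr])]
    simp
  have hcoord_neg : ∀ p q, p ≠ q → coord b (E q p) i = -coord b (E p q) i := by
    intro p q hpq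
    rw [coord_eq_sum b (s := {E p q}) (a := fun _ => -1) (f := id) (by simp [hneg p q hpq])]
    simp
  set c : Fin (k + 1) → ℤ := fun p => if p = 0 then 0 else coord b (E p 0) i with hc
  have hpot : ∀ p q, p ≠ q → coord b (E p q) i = c p - c q := by
    intro p q hpq
    by_cases hp0 : p = 0 <;> by_cases hq0 : q = 0
    · exact absurd (hp0.trans hq0.symm) hpq
    · subst hp0
      simp [hc, hq0, hcoord_neg _ _ hq0]
    · subst hq0
      simp [hc, hp0]
    · have := hcoord_add p q 0 hpq hq0 hp0
      simp only [hc, hp0, hq0, if_false]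
      omega
  -- the labels of the simple roots
  choose! s t hst hEst using hE'
  -- The expansion of `θ` in simple roots lifts to the vectors `ε_p - ε_q`: the defect `d` pairs to
  -- zero with every `ε_r - ε_r'`, so it is constant, and its entries sum to zero.
  have hrel : ∀ r, ((if s θ = r then 1 else 0) - (if t θ = r then 1 else 0) : ℤ) =
      ∑ j ∈ compSimple l, coord b θ j *
        ((if s j = r then 1 else 0) - (if t j = r then 1 else 0)) := by
    set d : Fin (k + 1) → ℤ := fun r =>
      ((if s θ = r then 1 else 0) - (if t θ = r then 1 else 0)) -
        ∑ j ∈ compSimple l, coord b θ j *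
          ((if s j = r then 1 else 0) - (if t j = r then 1 else 0)) with hd
    have hdd : ∀ r r', d r = d r' := by
      intro r r'
      by_cases hrr : r = r'
      · rw [hrr]
      have h1 := root'_eq_sum (comp_root_eq_sum hS₀ hθ hθ.1) (P.coroot (E r r'))
      simp only [P.root'_coroot_eq_pairing] at h1
      set z : ι → ℤ := fun γ => (if s γ = r then 1 else 0) - (if t γ = r then 1 else 0) -
        (if s γ = r' then 1 else 0) + (if t γ = r' then 1 else 0) with hz
      have h2 : ∀ γ ∈ compRoots l, P.pairing γ (E r r') =
          (z γ : ℂ) := by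
        intro γ hγ
        simp only [hz]
        rw [← hp _ _ _ _ (hst γ hγ) hrr, hEst γ hγ]
      rw [h2 θ hθ.1, Finset.sum_congr rfl fun j hj => by
        rw [h2 j (mem_compSimple.mp hj).2]] at h1
      have h3 : z θ = ∑ j ∈ compSimple l, coord b θ j * z j := by exact_mod_cast h1
      rw [← sub_eq_zero] at h3 ⊢
      rw [← h3]
      simp only [hd, hz]
      rw [show ∀ a b c e : ℤ, a - b - (c - e) = a - c - (b - e) by intros; ring,
        ← Finset.sum_sub_distrib]
      congr 1
      · ring
      · refine Finset.sum_congr rfl fun j _ => ?_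
        ring
    have hsum : ∑ r, d r = 0 := by
      simp only [hd, Finset.sum_sub_distrib]
      rw [Finset.sum_comm]
      simp [← Finset.mul_sum]
    intro r
    have h1 : ∑ r', d r' = (k + 1 : ℕ) * d r := by
      rw [Finset.sum_congr rfl fun r' _ => hdd r' r]
      simp
    rw [hsum] at h1
    have h2 : d r = 0 := by
      rcases mul_eq_zero.mp h1.symm with h | h
      · exact absurd h (by positivity)
      · exact h
    exact sub_eq_zero.mp h2
  have hf : ∀ f : Fin (k + 1) → ℤ, f (s θ) - f (t θ) =
      ∑ j ∈ compSimple l, coord b θ j * (f (s j) - f (t j)) := by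
    intro f
    have h1 := Finset.sum_congr (rfl : (Finset.univ : Finset (Fin (k + 1))) = _)
      fun r _ => congrArg (f r * ·) (hrel r)
    simp only [Finset.mul_sum] at h1
    rw [Finset.sum_comm] at h1
    simp only [mul_sub, Finset.sum_sub_distrib, mul_ite, mul_one, mul_zero, Finset.sum_ite_eq,
      Finset.mem_univ, if_true] at h1
    rw [h1, ← Finset.sum_sub_distrib]
    refine Finset.sum_congr rfl fun j _ => ?_
    ring
  have hpos := coord_maximal_pos hS₀ hθ hi
  -- A simple root `j ≠ i` has equal potentials at its two labels and drops out. The left side is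
  -- one because the potentials at the labels of `θ` differ. Thus the coefficient divides one.
  have h1 := hf (fun p => if c p = c (s θ) then 1 else 0)
  have hθc := hpot _ _ (hst θ hθ.1)
  rw [hEst θ hθ.1] at hθc
  rw [if_pos rfl, if_neg (by omega), Finset.sum_eq_single i] at h1
  · rw [sub_zero] at h1
    exact Int.eq_one_of_dvd_one hpos.le ⟨_, h1⟩
  · intro j hj hji
    have h2 := hpot _ _ (hst j (mem_compSimple.mp hj).2)
    rw [hEst j (mem_compSimple.mp hj).2, coord_of_mem_support b (compSimple_subset hS₀ l hj),
      if_neg (Ne.symm hji)] at h2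
    rw [show c (s j) = c (t j) by omega, sub_self, mul_zero]
  · exact fun h => absurd hi h

end TypeA

/-! ### A symmetric description of the arrangement -/

section ExtArrangement

variable {b : P.Base} {ℏ : ℂ} {θ : ι} {η : ι → ℂ} {S₀ : Finset ι} {θ' : Component P S₀ → ι}

variable (b ℏ θ η θ') in
/-- The points at which, for some `w` in the Weyl group, all elements `α` of the extended bases of the
components have a positive affine root `[w α, ℏ k]` with the value `η α`. -/
def extArrangement : Set V :=
  {x | ∃ w : P.weylGroup, ∀ l, ∀ α ∈ extSimple θ' l, ∃ k : ℤ,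
    AffPos b θ (P.weylGroupToPerm w α) k ∧ P.root' (P.weylGroupToPerm w α) x = η α - ℏ * k}

lemma exists_levels {Q : ι → ℤ → Prop} (h : ∀ l, ∀ α ∈ extSimple θ' l, ∃ k, Q α k) :
    ∃ k : ι → ℤ, ∀ l, ∀ α ∈ extSimple θ' l, Q α (k α) := by
  have hex : ∀ α, ∃ k : ℤ, ∀ l, α ∈ extSimple θ' l → Q α k := by
    intro α
    by_cases hα : ∃ l, α ∈ extSimple θ' l
    · obtain ⟨l, hl⟩ := hα
      obtain ⟨k, hk⟩ := h l α hl
      exact ⟨k, fun _ _ => hk⟩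
    · exact ⟨0, fun l hl => absurd ⟨l, hl⟩ hα⟩
  choose k hk using hex
  exact ⟨k, fun l α hα => hk α l hα⟩

lemma repr_root [P.IsRootSystem] (γ : ι) (j : b.support) :
    b.toWeightBasis.repr (P.root γ) j = coord b γ j := by
  have h : P.root γ = ∑ j : b.support, (coord b γ j : ℂ) • b.toWeightBasis j := by
    rw [root_eq_sum_coord b γ, ← Finset.sum_coe_sort]
    simp [Int.cast_smul_eq_zsmul]
  rw [h, b.toWeightBasis.repr_sum_self]

lemma apply_neg_of_invariant
    (hη : ∀ (w : P.weylGroup) (i : ι), η (P.weylGroupToPerm w i) = η i) (i : ι) :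
    η (P.reflectionPerm i i) = η i :=
  hη (RootPairing.weylGroup.ofIdx P i) i

variable (hS₀ : S₀ ⊆ b.support)
  (hθ' : ∀ l, IsMaximalRoot P (compSimple l : Set ι) (compRoots l) (θ' l))
include hS₀ hθ'

lemma comp_coxeterNumber [P.IsRootSystem] (l : Component P S₀) :
    coxeterNumber b η (θ' l) =
      η (θ' l) + ∑ j ∈ compSimple l, (coord b (θ' l) j : ℂ) * η j := by
  rw [coxeterNumber]
  congr 1
  simp_rw [repr_root]
  rw [Finset.sum_coe_sort b.support (fun j => (coord b (θ' l) j : ℂ) * η j)]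
  refine (Finset.sum_subset (compSimple_subset hS₀ l) fun j _ hj => ?_).symm
  rw [(hθ' l).coord_eq_zero_of_notMem (compSimple_subset hS₀ l) (fun _ => neg_mem_compRoots)
    (hθ' l).1 hj]
  simp

variable (hη : ∀ (w : P.weylGroup) (i : ι), η (P.weylGroupToPerm w i) = η i)
  {r : Component P S₀ → ℕ}
include hη

/-- The levels of the affine roots with gradients `w α`, weighted by the coefficients of the maximal
root, have the sum `r + 1`. -/
lemma sum_levels_eq [P.IsRootSystem] (hℏ : ℏ ≠ 0) {l : Component P S₀}
    (hcox : coxeterNumber b η (θ' l) = (r l + 1) * ℏ) {w : P.weylGroup} {x : V} {k : ι → ℤ}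
    (hk : ∀ α ∈ extSimple θ' l, P.root' (P.weylGroupToPerm w α) x = η α - ℏ * k α) :
    k (P.reflectionPerm (θ' l) (θ' l)) + ∑ j ∈ compSimple l, coord b (θ' l) j * k j = r l + 1 := by
  have h1 := root'_eq_sum (root_weyl_eq_sum w (f := id) (comp_root_eq_sum hS₀ (hθ' l) (hθ' l).1)) x
  have h2 := hk _ (mem_extSimple.mpr (Or.inl rfl))
  rw [weylGroupToPerm_neg, root'_neg, apply_neg_of_invariant hη, h1] at h2
  rw [Finset.sum_congr rfl fun j hj => by
    rw [id, hk j (mem_extSimple.mpr (Or.inr hj))]] at h2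
  rw [comp_coxeterNumber hS₀ hθ'] at hcox
  simp only [mul_sub, Finset.sum_sub_distrib, mul_left_comm _ ℏ, ← Finset.mul_sum] at h2
  have h3 : ℏ * ((k (P.reflectionPerm (θ' l) (θ' l)) +
      ∑ j ∈ compSimple l, coord b (θ' l) j * k j : ℤ) : ℂ) = ℏ * ((r l + 1 : ℤ) : ℂ) := by
    push_cast
    linear_combination hcox + h2
  exact_mod_cast mul_left_cancel₀ hℏ h3

variable [Finite ι] [P.IsCrystallographic] [P.IsRootSystem]
  (hθ : IsMaximalRoot P (b.support : Set ι) Set.univ θ)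
  (hr : ∀ l, r l = 0 ∨ ∀ j ∈ compSimple l, coord b (θ' l) j = 1)
  (hcox : ∀ l, coxeterNumber b η (θ' l) = (r l + 1) * ℏ)
include hθ hr hcox

/-- The level at `-θ'` is forced to be `r + 1 - ∑ n_j ξ(w j)`. It is at least one because either `r
= 0` and all these `ξ` vanish, or all `n_j` are one. -/
lemma arrangement_subset_extArrangement :
    arrangement b ℏ η r ⊆ extArrangement b ℏ θ η θ' := by
  intro x hx
  simp only [arrangement, Set.mem_iUnion] at hx
  obtain ⟨w, ξ, ⟨hξ, hξr⟩, hx⟩ := hx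
  have hmem : ∀ {l : Component P S₀} {α}, α ∈ compSimple l →
      P.weylGroupToPerm w α ∈ P.weylGroupToPerm w '' (S₀ : Set ι) := fun h =>
    ⟨_, (mem_compSimple.mp h).1, rfl⟩
  refine ⟨w, fun l α hα => ?_⟩
  rcases mem_extSimple.mp hα with rfl | hα
  · have hle : ∑ j ∈ compSimple l, coord b (θ' l) j * ξ (P.weylGroupToPerm w j) ≤ r l := by
      rcases hr l with h | h
      · have h0 := hξr l
        rw [h, Nat.le_zero, Finset.sum_eq_zero_iff] at h0
        rw [Finset.sum_eq_zero fun j hj => by rw [h0 j hj]; simp]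
        positivity
      · rw [Finset.sum_congr rfl fun j hj => by rw [h j hj, one_mul]]
        exact_mod_cast hξr l
    refine ⟨r l + 1 - ∑ j ∈ compSimple l, coord b (θ' l) j * ξ (P.weylGroupToPerm w j),
      (affPos_iff hθ).mpr (Or.inl (by omega)), ?_⟩
    have h1 := root'_eq_sum (root_weyl_eq_sum w (f := id)
      (comp_root_eq_sum hS₀ (hθ' l) (hθ' l).1)) x
    rw [weylGroupToPerm_neg, root'_neg, apply_neg_of_invariant hη, h1,
      Finset.sum_congr rfl fun j hj => by rw [id, hx _ (hmem hj), hη]]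
    have h2 := hcox l
    rw [comp_coxeterNumber hS₀ hθ'] at h2
    simp only [mul_sub, Finset.sum_sub_distrib, mul_left_comm _ ℏ, ← Finset.mul_sum]
    push_cast
    linear_combination -h2
  · refine ⟨ξ (P.weylGroupToPerm w α), (affPos_iff hθ).mpr ?_, ?_⟩
    · rcases Nat.eq_zero_or_pos (ξ (P.weylGroupToPerm w α)) with h | h
      · exact Or.inr ⟨by exact_mod_cast h, hξ _ (hmem hα) h⟩
      · exact Or.inl (by exact_mod_cast h)
    · rw [hx _ (hmem hα), hη]
      simp

lemma extArrangement_subset_arrangement [P.IsReduced] (hℏ : ℏ ≠ 0) :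
    extArrangement b ℏ θ η θ' ⊆ arrangement b ℏ η r := by
  classical
  rintro x ⟨w, hw⟩
  obtain ⟨k, hk⟩ := exists_levels hw
  have hsum := fun l => sum_levels_eq hS₀ hθ' hη hℏ (hcox l) (w := w) (k := k)
    fun α hα => (hk l α hα).2
  have hk0 : ∀ l, ∀ α ∈ extSimple θ' l, 0 ≤ k α := fun l α hα =>
    nonneg_of_affPos hθ (hk l α hα).1
  have hneg : ∀ l, P.reflectionPerm (θ' l) (θ' l) ∈ extSimple θ' l := fun l =>
    mem_extSimple.mpr (Or.inl rfl)
  -- a node of each extended base with coefficient one and positive level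
  have hi : ∀ l, ∃ i ∈ extSimple θ' l, (i ∈ compSimple l → coord b (θ' l) i = 1) ∧ 0 < k i := by
    intro l
    by_cases h : 0 < k (P.reflectionPerm (θ' l) (θ' l))
    · exact ⟨_, hneg l, fun h => absurd h (neg_maximal_notMem hS₀ hθ' l), h⟩
    · have h0 := hk0 l _ (hneg l)
      have hs := hsum l
      have h1 : ∑ j ∈ compSimple l, coord b (θ' l) j * k j = r l + 1 := by omega
      obtain ⟨j, hj, hj0⟩ := Finset.exists_ne_zero_of_sum_ne_zero
        (h1.trans_ne (by positivity))
      have hkj := hk0 l j (mem_extSimple.mpr (Or.inr hj))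
      have hkj' : 0 < k j := lt_of_le_of_ne hkj (Ne.symm (right_ne_zero_of_mul hj0))
      refine ⟨j, mem_extSimple.mpr (Or.inr hj), fun _ => ?_, hkj'⟩
      -- If `r = 0`, the term `n_j k_j` is at most one with both factors positive, so `n_j = 1`.
      rcases hr l with h2 | h2
      · have h3 := Finset.single_le_sum (f := fun j => coord b (θ' l) j * k j) (fun i hi =>
          mul_nonneg (coord_maximal_pos hS₀ (hθ' l) hi).le
            (hk0 l i (mem_extSimple.mpr (Or.inr hi)))) hj
        have h4 := coord_maximal_pos hS₀ (hθ' l) hj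
        simp only [h1, h2] at h3
        push_cast at h3
        nlinarith
      · exact h2 j hj
  choose i hi hi1 hik using hi
  obtain ⟨u, hu⟩ := exists_weyl_image_eq_erase hS₀ hθ' i hi hi1
  have hmul : ∀ α, P.weylGroupToPerm (w * u) α = P.weylGroupToPerm w (P.weylGroupToPerm u α) := by
    intro α
    rw [map_mul, Equiv.Perm.mul_apply]
  -- The levels are indexed by roots before applying `w`, hence the inverse. Truncation is harmless
  -- because the relevant levels are non-negative.
  set ξ : ι → ℕ := fun β => (k ((P.weylGroupToPerm w).symm β)).toNat with hξ
  have hξα : ∀ α, ξ (P.weylGroupToPerm (w * u) α) = (k (P.weylGroupToPerm u α)).toNat := by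
    intro α
    simp only [hξ, hmul, Equiv.symm_apply_apply]
  have hcomp : ∀ α ∈ S₀, ∃ l : Component P S₀, α ∈ compSimple l := by
    intro α hα
    obtain ⟨l, hl⟩ := exists_mem_compRoots (subset_subRoots (P := P) hα)
    exact ⟨l, mem_compSimple.mpr ⟨hα, hl⟩⟩
  simp only [arrangement, Set.mem_iUnion]
  refine ⟨w * u, ξ, ⟨?_, fun l => ?_⟩, ?_⟩
  · rintro _ ⟨α, hα, rfl⟩ h0
    obtain ⟨l, hl⟩ := hcomp α hα
    have h1 := (hk l _ (hu l α hl).1).1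
    have h2 := hk0 l _ (hu l α hl).1
    rw [hξα] at h0
    rw [affPos_iff hθ] at h1
    rw [hmul]
    rcases h1 with h1 | h1
    · omega
    · exact h1.2
  · simp only [hξα]
    have h1 : ∑ α ∈ compSimple l, k (P.weylGroupToPerm u α) ≤
        ∑ α ∈ (extSimple θ' l).erase (i l), k α := by
      rw [← Finset.sum_image (f := k) (g := P.weylGroupToPerm u)
        (fun x _ y _ h => (P.weylGroupToPerm u).injective h)]
      refine Finset.sum_le_sum_of_subset_of_nonneg ?_ fun α hα _ =>
        hk0 l α (Finset.mem_of_mem_erase hα)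
      intro σ hσ
      obtain ⟨α, hα, rfl⟩ := Finset.mem_image.mp hσ
      exact Finset.mem_erase.mpr ⟨(hu l α hα).2, (hu l α hα).1⟩
    have h2 := Finset.add_sum_erase _ k (hi l)
    -- All `n_j` are at least one, so the unweighted levels sum to at most `r + 1`. Removing the
    -- node `i l`, of level at least one, leaves at most `r`.
    have h3 : ∑ α ∈ extSimple θ' l, k α ≤ k (P.reflectionPerm (θ' l) (θ' l)) +
        ∑ j ∈ compSimple l, coord b (θ' l) j * k j := by
      rw [extSimple, Finset.sum_insert (neg_maximal_notMem hS₀ hθ' l)]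
      refine add_le_add le_rfl (Finset.sum_le_sum fun j hj => ?_)
      have h4 := coord_maximal_pos hS₀ (hθ' l) hj
      have h5 := hk0 l j (mem_extSimple.mpr (Or.inr hj))
      nlinarith
    have h4 := hsum l
    have h5 := hik l
    have h6 : ∑ α ∈ compSimple l, k (P.weylGroupToPerm u α) ≤ r l := by omega
    have h7 : ((∑ α ∈ compSimple l, (k (P.weylGroupToPerm u α)).toNat : ℕ) : ℤ) =
        ∑ α ∈ compSimple l, k (P.weylGroupToPerm u α) := by
      push_cast
      exact Finset.sum_congr rfl fun α hα => Int.toNat_of_nonneg (hk0 l _ (hu l α hα).1)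
    omega
  · rintro _ ⟨α, hα, rfl⟩
    obtain ⟨l, hl⟩ := hcomp α hα
    have h1 := (hk l _ (hu l α hl).1).2
    have h2 : ((k (P.weylGroupToPerm u α)).toNat : ℂ) = k (P.weylGroupToPerm u α) := by
      exact_mod_cast congrArg (Int.cast : ℤ → ℂ)
        (Int.toNat_of_nonneg (hk0 l _ (hu l α hl).1))
    rw [hξα, hmul, h1, h2, hη w]

lemma arrangement_eq_extArrangement [P.IsReduced] (hℏ : ℏ ≠ 0) :
    arrangement b ℏ η r = extArrangement b ℏ θ η θ' :=
  (arrangement_subset_extArrangement hS₀ hθ' hη hθ hr hcox).antisymm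
    (extArrangement_subset_arrangement hS₀ hθ' hη hθ hr hcox hℏ)

end ExtArrangement

/-! ### The extended affine Weyl group and the group `Π` -/

section Pi

lemma exists_root'_eq [P.IsRootSystem] (b : P.Base) (c : ι → ℂ) :
    ∃ x : V, ∀ i ∈ b.support, P.root' i x = c i := by
  refine ⟨P.toLinearMap.flip.toPerfPair.symm (b.toWeightBasis.constr ℂ fun i => c i),
    fun i hi => ?_⟩
  have h := LinearMap.congr_fun (P.toLinearMap.flip.toPerfPair.apply_symm_apply
    (b.toWeightBasis.constr ℂ fun i => c i)) (b.toWeightBasis ⟨i, hi⟩)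
  rw [Module.Basis.constr_basis] at h
  simpa using h

lemma eq_of_root'_eq [P.IsRootSystem] (b : P.Base) {x y : V}
    (h : ∀ i ∈ b.support, P.root' i x = P.root' i y) : x = y := by
  apply P.toLinearMap.flip.toPerfPair.injective
  refine b.toWeightBasis.ext fun i => ?_
  simpa using h i i.2

lemma root'_eq_height {b : P.Base} {x : V} {c : ℂ} (hx : ∀ i ∈ b.support, P.root' i x = c)
    (γ : ι) : P.root' γ x = b.height γ * c := by
  rw [root'_eq_sum (f := id) (root_eq_sum_coord b γ), height_eq_val, val]
  push_cast
  rw [Finset.sum_mul]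
  refine Finset.sum_congr rfl fun j hj => ?_
  rw [id, hx j hj]
  simp

lemma root'_reflectionPerm_affRefl (ℏ : ℂ) (i : ι) (e : ℤ) (γ : ι) (x : V) :
    P.root' (P.reflectionPerm i γ) (affRefl P ℏ i e x) =
      P.root' γ x + P.pairing γ i * (ℏ * e) := by
  rw [root'_reflectionPerm, affRefl_apply, affRoot_apply]
  simp only [map_sub, map_smul, smul_eq_mul, P.root'_coroot_eq_pairing, P.pairing_same]
  ring

/-- An element of the extended affine Weyl group acts on affine roots, by an element of the Weyl group
on the gradients. -/
lemma exists_weyl_of_mem_extAffWeyl {ℏ : ℂ} {g : V ≃ᵃ[ℂ] V} (hg : g ∈ extAffWeyl P ℏ) :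
    ∃ u : P.weylGroup, ∀ (γ : ι) (k : ℤ), ∃ k' : ℤ, ∀ x,
      affRoot P ℏ (P.weylGroupToPerm u γ) k' (g x) = affRoot P ℏ γ k x := by
  induction hg using Subgroup.closure_induction with
  | mem g hg =>
    rcases hg with ⟨i, rfl⟩ | ⟨v, hv, rfl⟩
    · refine ⟨RootPairing.weylGroup.ofIdx P i, fun γ k => ⟨k, fun x => ?_⟩⟩
      rw [weylGroupToPerm_ofIdx, affRoot_apply, root'_reflectionPerm_affRefl, affRoot_apply]
      simp
    · refine ⟨1, fun γ k => ?_⟩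
      obtain ⟨n, hn⟩ := hv γ
      refine ⟨k - n, fun x => ?_⟩
      simp only [map_one, Equiv.Perm.one_apply, affRoot_apply, translation,
        AffineEquiv.constVAdd_apply, vadd_eq_add, map_add, map_smul, smul_eq_mul, hn]
      push_cast
      ring
  | one => exact ⟨1, fun γ k => ⟨k, fun x => by simp⟩⟩
  | mul g h _ _ ihg ihh =>
    obtain ⟨u, hu⟩ := ihg
    obtain ⟨v, hv⟩ := ihh
    refine ⟨u * v, fun γ k => ?_⟩
    obtain ⟨k', hk'⟩ := hv γ k
    obtain ⟨k'', hk''⟩ := hu (P.weylGroupToPerm v γ) k'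
    refine ⟨k'', fun x => ?_⟩
    rw [map_mul, Equiv.Perm.mul_apply, AffineEquiv.mul_def, AffineEquiv.trans_apply, hk'', hk']
  | inv g _ ih =>
    obtain ⟨u, hu⟩ := ih
    refine ⟨u⁻¹, fun γ k => ?_⟩
    obtain ⟨k', hk'⟩ := hu (P.weylGroupToPerm u⁻¹ γ) 0
    refine ⟨k - k', fun x => ?_⟩
    have h1 := hk' (g⁻¹ x)
    have h2 : g (g⁻¹ x) = x := g.apply_symm_apply x
    have h3 : P.weylGroupToPerm u (P.weylGroupToPerm u⁻¹ γ) = γ := by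
      rw [← Equiv.Perm.mul_apply, ← map_mul, mul_inv_cancel, map_one, Equiv.Perm.one_apply]
    rw [h2, h3] at h1
    simp only [affRoot_apply] at h1 ⊢
    push_cast at h1 ⊢
    linear_combination -h1

variable {b : P.Base} {ℏ : ℂ} {θ : ι}

/-- The elements of `Π` preserve the heights of affine roots. -/
lemma exists_weyl_of_mem_groupPi [P.IsRootSystem] (hℏ : ℏ ≠ 0)
    (hθ : IsMaximalRoot P (b.support : Set ι) Set.univ θ) {g : V ≃ᵃ[ℂ] V}
    (hg : g ∈ groupPi b ℏ θ) :
    ∃ u : P.weylGroup, ∀ (γ : ι) (k : ℤ), AffPos b θ γ k → ∃ k' : ℤ,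
      AffPos b θ (P.weylGroupToPerm u γ) k' ∧ ∀ x,
        affRoot P ℏ (P.weylGroupToPerm u γ) k' (g x) = affRoot P ℏ γ k x := by
  obtain ⟨u, hu⟩ := exists_weyl_of_mem_extAffWeyl hg.1
  have hh : (b.height θ + 1 : ℂ) ≠ 0 := by
    have := height_maximal_pos hθ
    exact_mod_cast (show b.height θ + 1 ≠ 0 by omega)
  -- At this point all affine simple roots, including `α₀`, have the same value, and an affine root
  -- has that value times its affine height. Permuting the affine simple roots therefore fixes `x₀`
  -- and preserves heights.
  obtain ⟨x₀, hx₀⟩ := exists_root'_eq b (fun _ => ℏ / (b.height θ + 1))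
  have hval : ∀ γ (k : ℤ), affRoot P ℏ γ k x₀ =
      ℏ / (b.height θ + 1) * ((b.height γ + (b.height θ + 1) * k : ℤ) : ℂ) := by
    intro γ k
    rw [affRoot_apply, root'_eq_height hx₀]
    push_cast
    field_simp
  have hfix : g x₀ = x₀ := by
    refine eq_of_root'_eq b fun i hi => ?_
    have h1 : actFunctional g⁻¹ (simpleAff b ℏ θ (some ⟨i, hi⟩)) ∈
        Set.range (simpleAff b ℏ θ) := by
      rw [← (inv_mem hg).2]
      exact ⟨_, ⟨_, rfl⟩, rfl⟩
    obtain ⟨j, hj⟩ := h1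
    have h2 : simpleAff b ℏ θ j x₀ = simpleAff b ℏ θ (some ⟨i, hi⟩) (g x₀) := by
      rw [hj]
      rfl
    have hnode : ∀ j : Node b, simpleAff b ℏ θ j x₀ = ℏ / (b.height θ + 1) := by
      intro j
      rw [simpleAff, hval, affineHeight_node, Int.cast_one, mul_one]
    rw [hnode, simpleAff, affRoot_apply] at h2
    rw [hx₀ i hi, h2]
    simp [nodeRoot, nodeLevel]
  refine ⟨u, fun γ k hγ => ?_⟩
  obtain ⟨k', hk'⟩ := hu γ k
  refine ⟨k', ?_, hk'⟩
  have h1 := hk' x₀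
  rw [hfix, hval, hval] at h1
  have h2 := mul_left_cancel₀ (div_ne_zero hℏ hh) h1
  rw [AffPos, Int.cast_injective h2]
  exact hγ

lemma extArrangement_groupPi [P.IsRootSystem] {η : ι → ℂ} {S₀ : Finset ι}
    {θ' : Component P S₀ → ι} (hℏ : ℏ ≠ 0)
    (hθ : IsMaximalRoot P (b.support : Set ι) Set.univ θ) {g : V ≃ᵃ[ℂ] V}
    (hg : g ∈ groupPi b ℏ θ) {x : V} (hx : x ∈ extArrangement b ℏ θ η θ') :
    g x ∈ extArrangement b ℏ θ η θ' := by
  obtain ⟨w, hw⟩ := hx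
  obtain ⟨u, hu⟩ := exists_weyl_of_mem_groupPi hℏ hθ hg
  refine ⟨u * w, fun l α hα => ?_⟩
  obtain ⟨k, hk, hkx⟩ := hw l α hα
  obtain ⟨k', hk', hx'⟩ := hu _ k hk
  rw [map_mul, Equiv.Perm.mul_apply]
  refine ⟨k', hk', ?_⟩
  have h := hx' x
  simp only [affRoot_apply] at h
  linear_combination h + hkx

/-- A fundamental coweight serves for a simple root, and reflections carry it to all other roots. -/
lemma exists_coweight_eq_one [Finite ι] [P.IsCrystallographic] [P.IsReduced] [P.IsRootSystem]
    (b : P.Base) (γ : ι) : ∃ v ∈ coweightLattice P, P.root' γ v = 1 := by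
  classical
  refine b.induction_reflect γ (p := fun γ => ∃ v ∈ coweightLattice P, P.root' γ v = 1) ?_ ?_ ?_
  · rintro i ⟨v, hv, h⟩
    exact ⟨-v, neg_mem hv, by rw [root'_neg, map_neg, h, neg_neg]⟩
  · intro i hi
    obtain ⟨v, hv⟩ := exists_root'_eq b (fun j => if j = i then 1 else 0)
    refine ⟨v, fun γ => ⟨coord b γ i, ?_⟩, by simp [hv i hi]⟩
    rw [root'_eq_sum (f := id) (root_eq_sum_coord b γ), Finset.sum_eq_single i]
    · simp [hv i hi]
    · intro j hj hji
      simp [hv j hj, hji]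
    · exact fun h => absurd hi h
  · rintro i j ⟨v, hv, h⟩ -
    have key : ∀ γ, P.root' γ (P.coreflection j v) = P.root' (P.reflectionPerm j γ) v := by
      intro γ
      rw [root'_reflectionPerm, P.coreflection_apply]
      simp only [map_sub, map_smul, smul_eq_mul, P.root'_coroot_eq_pairing]
      ring
    refine ⟨P.coreflection j v, fun γ => ?_, ?_⟩
    · rw [key]
      exact hv _
    · rw [key, P.reflectionPerm_self, h]

/-- Translation by a coweight pairing to one with the gradient shifts the level by one. This carries
the condition on `t`, imposed at level zero, to the level one root `α₀`. -/
lemma parameter_succ [Finite ι] [P.IsCrystallographic] [P.IsReduced] [P.IsRootSystem]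
    (b : P.Base) {t : ι → ℤ → ℂ} (ht : ∀ g ∈ extAffWeyl P ℏ, ∀ i k j l,
      actFunctional g (affRoot P ℏ i k) = affRoot P ℏ j l → t j l = t i k) (i : ι) (k : ℤ) :
    t i (k + 1) = t i k := by
  obtain ⟨v, hv, hi⟩ := exists_coweight_eq_one b i
  refine ht (translation (ℏ • -v)) (Subgroup.subset_closure (Or.inr ⟨-v, neg_mem hv, rfl⟩)) _ _ _ _
    ?_
  ext x
  show affRoot P ℏ i k ((translation (ℏ • -v)).symm x) = _
  rw [translation, AffineEquiv.constVAdd_symm, AffineEquiv.constVAdd_apply, affRoot_apply,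
    affRoot_apply]
  simp only [vadd_eq_add, smul_neg, neg_neg, map_add, map_smul, hi, smul_eq_mul]
  push_cast
  ring

end Pi

/-! ### Invariance under the Demazure–Lusztig operators -/

section Reflections

variable {b : P.Base} {ℏ : ℂ} {θ : ι} {η : ι → ℂ} {S₀ : Finset ι} {θ' : Component P S₀ → ι}

variable (b ℏ θ η θ') in
/-- The affine roots `[w α, ℏ k(α)]` are positive and have the value `η α` at `x`, for the elements `α`
of the extended bases. -/
def HasLevels (w : P.weylGroup) (k : ι → ℤ) (x : V) : Prop :=
  ∀ l, ∀ α ∈ extSimple θ' l, AffPos b θ (P.weylGroupToPerm w α) (k α) ∧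
    P.root' (P.weylGroupToPerm w α) x = η α - ℏ * k α

lemma mem_extArrangement {x : V} :
    x ∈ extArrangement b ℏ θ η θ' ↔ ∃ w k, HasLevels b ℏ θ η θ' w k x := by
  refine ⟨fun ⟨w, hw⟩ => ?_, fun ⟨w, k, h⟩ => ⟨w, fun l α hα => ⟨k α, h l α hα⟩⟩⟩
  obtain ⟨k, hk⟩ := exists_levels hw
  exact ⟨w, k, hk⟩

lemma HasLevels.affRefl_mem [Finite ι] [P.IsCrystallographic] [P.IsReduced]
    (hθ : IsMaximalRoot P (b.support : Set ι) Set.univ θ) {w : P.weylGroup} {k : ι → ℤ} {x : V}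
    (h : HasLevels b ℏ θ η θ' w k x) (j : Node b)
    (hne : ∀ l, ∀ α ∈ extSimple θ' l,
      ¬ (P.weylGroupToPerm w α = nodeRoot b θ j ∧ k α = nodeLevel b j)) :
    affRefl P ℏ (nodeRoot b θ j) (nodeLevel b j) x ∈ extArrangement b ℏ θ η θ' := by
  refine ⟨RootPairing.weylGroup.ofIdx P (nodeRoot b θ j) * w, fun l α hα => ?_⟩
  obtain ⟨h1, h2⟩ := h l α hα
  rw [map_mul, Equiv.Perm.mul_apply, weylGroupToPerm_ofIdx]
  refine ⟨_, affPos_reflection hθ j h1 (hne l α hα), ?_⟩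
  rw [root'_reflectionPerm_affRefl, h2, ← P.algebraMap_pairingIn ℤ]
  push_cast
  simp only [eq_intCast]
  ring

/-- A functional that kills the span of `S₀` but not the given root, transported by `w`, is a
direction along the plane. -/
lemma HasLevels.exists_direction [P.IsRootSystem]
    (hθ' : ∀ l, IsMaximalRoot P (compSimple l : Set ι) (compRoots l) (θ' l)) (w : P.weylGroup)
    {γ : ι} (hγ : γ ∉ subRoots P S₀) :
    ∃ v : V, P.root' (P.weylGroupToPerm w γ) v = 1 ∧ ∀ k x, HasLevels b ℏ θ η θ' w k x →
      ∀ c : ℂ, HasLevels b ℏ θ η θ' w k (x + c • v) := by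
  obtain ⟨f, hf, hfS⟩ := Submodule.exists_le_ker_of_notMem
    (show P.root γ ∉ Submodule.span ℂ (P.root '' S₀) from hγ)
  set v := P.toLinearMap.flip.toPerfPair.symm (f ∘ₗ P.weylGroupRootRep w⁻¹) with hv
  have hroot : ∀ δ, P.root' (P.weylGroupToPerm w δ) v = f (P.root δ) := by
    intro δ
    have h := LinearMap.congr_fun (P.toLinearMap.flip.toPerfPair.apply_symm_apply
      (f ∘ₗ P.weylGroupRootRep w⁻¹)) (P.root (P.weylGroupToPerm w δ))
    have h2 : P.weylGroupRootRep w⁻¹ (P.root (P.weylGroupToPerm w δ)) = P.root δ := by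
      rw [← P.weylGroup_apply_root]
      exact inv_smul_smul w _
    rw [LinearMap.comp_apply, h2] at h
    exact h
  refine ⟨(f (P.root γ))⁻¹ • v, ?_, fun k x hx c l α hα => ⟨(hx l α hα).1, ?_⟩⟩
  · rw [map_smul, hroot, smul_eq_mul, inv_mul_cancel₀ hf]
  · have h0 : f (P.root α) = 0 := hfS (extSimple_subset_compRoots hθ' l hα).1
    rw [map_add, map_smul, map_smul, hroot, h0, (hx l α hα).2]
    simp

end Reflections

/-! ### Affine roots with gradient in a component -/

section NonIntegrality

variable {b : P.Base} {ℏ : ℂ} {θ : ι} {η : ι → ℂ} {S₀ : Finset ι} {θ' : Component P S₀ → ι}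
  (hS₀ : S₀ ⊆ b.support)
  (hθ' : ∀ l, IsMaximalRoot P (compSimple l : Set ι) (compRoots l) (θ' l))
  (hη : ∀ (w : P.weylGroup) (i : ι), η (P.weylGroupToPerm w i) = η i)
  {r : Component P S₀ → ℕ} {w : P.weylGroup} {k : ι → ℤ} {x : V}
  (hx : HasLevels b ℏ θ η θ' w k x)
include hS₀ hθ' hη hx

/-- If `r = 0`, an affine simple root whose gradient lies in a component is one of the affine roots that
define the plane. -/
lemma HasLevels.exists_eq_node [P.IsRootSystem] (hℏ : ℏ ≠ 0) {l : Component P S₀}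
    (hcox : coxeterNumber b η (θ' l) = (r l + 1) * ℏ) (hr : r l = 0) {j : Node b} {γ : ι}
    (hγ : γ ∈ compRoots l) (hj : P.weylGroupToPerm w γ = nodeRoot b θ j) :
    ∃ α ∈ extSimple θ' l, P.weylGroupToPerm w α = nodeRoot b θ j ∧ k α = nodeLevel b j := by
  classical
  set ht : ι → ℤ := fun α => b.height (P.weylGroupToPerm w α) + (b.height θ + 1) * k α with hht
  obtain ⟨ν, hν⟩ : ∃ ν, ν = P.reflectionPerm (θ' l) (θ' l) := ⟨_, rfl⟩
  set n : ι → ℤ := coord b (θ' l) with hn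
  set m : ι → ℤ := coord b γ with hm
  have hνS : ν ∉ compSimple l := hν ▸ neg_maximal_notMem hS₀ hθ' l
  have hext : ∀ α ∈ extSimple θ' l, α = ν ∨ α ∈ compSimple l := fun α hα =>
    hν ▸ mem_extSimple.mp hα
  have hpos : ∀ α ∈ extSimple θ' l, 1 ≤ ht α := fun α hα => (hx l α hα).1
  have hk := sum_levels_eq hS₀ hθ' hη hℏ hcox (k := k) (fun α hα => (hx l α hα).2)
  rw [hr, Nat.cast_zero, zero_add, ← hν, ← hn] at hk
  have hrθ := comp_root_eq_sum hS₀ (hθ' l) (hθ' l).1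
  have hrγ := comp_root_eq_sum hS₀ (hθ' l) hγ
  have hhθ := height_eq_sum_height b (root_weyl_eq_sum w (f := id) hrθ)
  have hhγ := height_eq_sum_height b (root_weyl_eq_sum w (f := id) hrγ)
  simp only [id, ← hn, ← hm] at hhθ hhγ
  have hhν : b.height (P.weylGroupToPerm w ν) = -b.height (P.weylGroupToPerm w (θ' l)) := by
    rw [hν, weylGroupToPerm_neg, height_neg]
  -- the coefficients of the affine simple root
  set c : ℤ := nodeLevel b j - ∑ i ∈ compSimple l, m i * k i with hc
  set A : ι → ℤ := fun α => if α = ν then c else m α + c * n α with hA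
  have hAS : ∀ α ∈ compSimple l, A α = m α + c * n α := fun α hα =>
    if_neg fun h : α = ν => hνS (h ▸ hα)
  have hAν : A ν = c := if_pos rfl
  -- As `r = 0`, the defining affine roots weighted by the `n_α` add up to `[0, ℏ]`. Hence `α_j = ∑
  -- A_α [wα, ℏ k_α]`, and affine heights are additive, with `α_j` of height one.
  have hsum : ∑ α ∈ extSimple θ' l, A α * ht α = 1 := by
    rw [← affineHeight_node (b := b) (θ := θ) j, ← hj, extSimple, ← hν, Finset.sum_insert hνS, hAν,
      Finset.sum_congr rfl fun α hα => by rw [hAS α hα]]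
    simp only [hht, hhν, hhθ, hhγ]
    have e1 : ∑ i ∈ compSimple l, (m i + c * n i) *
        (b.height (P.weylGroupToPerm w i) + (b.height θ + 1) * k i) =
        ∑ i ∈ compSimple l, m i * b.height (P.weylGroupToPerm w i) +
        c * ∑ i ∈ compSimple l, n i * b.height (P.weylGroupToPerm w i) +
        (b.height θ + 1) * ∑ i ∈ compSimple l, m i * k i +
        (b.height θ + 1) * c * ∑ i ∈ compSimple l, n i * k i := by
      simp only [Finset.mul_sum, ← Finset.sum_add_distrib]
      exact Finset.sum_congr rfl fun i _ => by ring
    rw [e1]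
    linear_combination (b.height θ + 1) * c * hk + (b.height θ + 1) * hc
  -- Since `|m_i| ≤ n_i`, a non-zero integer `c` determines the sign of `m_i + c n_i`. For `c = 0`
  -- the coordinates of a root have one sign.
  have hsign : (∀ α ∈ extSimple θ' l, 0 ≤ A α) ∨ ∀ α ∈ extSimple θ' l, A α ≤ 0 := by
    have hle := fun i => (hθ' l).coord_le (compSimple_subset hS₀ l) hγ i
    have hge := fun i => (hθ' l).neg_le_coord (compSimple_subset hS₀ l)
      (fun _ => neg_mem_compRoots) hγ i
    have hn0 := fun i => (hθ' l).coord_nonneg (compSimple_subset hS₀ l)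
      (fun _ => neg_mem_compRoots) i
    simp only [← hn, ← hm] at hle hge hn0
    rcases lt_trichotomy c 0 with h | h | h
    · right
      intro α hα
      rcases hext α hα with rfl | hα
      · exact hAν.trans_le h.le
      · rw [hAS α hα]
        nlinarith [hle α, hn0 α]
    · refine (coord_nonneg_or_nonpos b γ).imp (fun h' α hα => ?_) fun h' α hα => ?_
      all_goals
        rcases hext α hα with rfl | hα
        · rw [hAν, h]
        · rw [hAS α hα, h, zero_mul, add_zero]
          exact h' α
    · left
      intro α hα
      rcases hext α hα with rfl | hα
      · exact h.le.trans_eq hAν.symm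
      · rw [hAS α hα]
        nlinarith [hge α, hn0 α]
  have hnn : ∀ α ∈ extSimple θ' l, 0 ≤ A α := by
    refine hsign.resolve_right fun h => ?_
    have := Finset.sum_nonpos fun α hα =>
      mul_nonpos_of_nonpos_of_nonneg (h α hα) (zero_le_one.trans (hpos α hα))
    omega
  -- Non-negative coefficients against heights at least one sum to one, so `α_j` is a single
  -- defining root.
  obtain ⟨α, hα, hα1, -, hα0⟩ := exists_unique_term_of_sum_mul_eq_one hnn hpos hsum
  refine ⟨α, hα, ?_⟩
  have hνmem : ν ∈ extSimple θ' l := mem_extSimple.mpr (Or.inl hν)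
  have hSmem : ∀ i ∈ compSimple l, i ∈ extSimple θ' l := fun i hi =>
    mem_extSimple.mpr (Or.inr hi)
  rw [← hj]
  rcases hext α hα with h | hαS
  · subst h
    have hc1 : c = 1 := hAν.symm.trans hα1
    have hmn : ∀ i ∈ compSimple l, m i = -n i := by
      intro i hi
      have h1 := hα0 i (hSmem i hi) fun h => hνS (h ▸ hi)
      rw [hAS i hi, hc1] at h1
      omega
    refine ⟨congrArg _ (root_eq_of_coord_eq b fun i hi => ?_), ?_⟩
    · rw [hν, coord_neg]
      by_cases hiS : i ∈ compSimple l
      · exact (hmn i hiS).symm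
      · rw [(hθ' l).coord_eq_zero_of_notMem (compSimple_subset hS₀ l)
          (fun _ => neg_mem_compRoots) hγ hiS,
          (hθ' l).coord_eq_zero_of_notMem (compSimple_subset hS₀ l)
          (fun _ => neg_mem_compRoots) (hθ' l).1 hiS, neg_zero]
    · rw [Finset.sum_congr rfl fun i hi => by rw [hmn i hi]] at hc
      simp only [neg_mul, Finset.sum_neg_distrib] at hc
      omega
  · have hc0 : c = 0 := hAν.symm.trans (hα0 ν hνmem fun h => hνS (h ▸ hαS))
    have hm1 : m α = 1 := by
      have h1 := hAS α hαS
      rw [hα1, hc0] at h1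
      omega
    have hm0 : ∀ i ∈ compSimple l, i ≠ α → m i = 0 := by
      intro i hi hiα
      have h1 := hα0 i (hSmem i hi) hiα
      rw [hAS i hi, hc0] at h1
      omega
    refine ⟨congrArg _ (P.root.injective ?_), ?_⟩
    · rw [hrγ, Finset.sum_eq_single α (fun i hi hiα => by rw [← hm, hm0 i hi hiα, zero_smul])
        (fun h => absurd hαS h), ← hm, hm1, one_smul]
    · rw [Finset.sum_eq_single α (fun i hi hiα => by rw [hm0 i hi hiα, zero_mul])
        (fun h => absurd hαS h), hm1] at hc
      omega

/-- On a component of type `A`, affine roots do not take values in `2πiℤ`. -/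
lemma HasLevels.exp_ne_one_of_isTypeA [Finite ι] [P.IsRootSystem]
    (hℏ : ∀ q : ℚ, ℏ ≠ Real.pi * Complex.I * q) {l : Component P S₀}
    (hcox : coxeterNumber b η (θ' l) = (r l + 1) * ℏ)
    (hA : IsTypeA P (compRoots l) (compSimple l).card)
    (hgcd : Nat.gcd (r l + 1) ((compSimple l).card + 1) = 1) {γ : ι} (hγ : γ ∈ compRoots l)
    (e : ℤ) : Complex.exp (-(affRoot P ℏ (P.weylGroupToPerm w γ) e x)) ≠ 1 := by
  intro h
  obtain ⟨N, hN⟩ := Complex.exp_eq_one_iff.mp h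
  have hn : ∀ j ∈ compSimple l, coord b (θ' l) j = 1 := fun j hj =>
    hA.coord_maximal hS₀ (hθ' l) hj
  have hηc : ∀ j ∈ compSimple l, η j = η (θ' l) := fun j hj =>
    hA.eq_of_invariant (fun i j => hη (RootPairing.weylGroup.ofIdx P i) j)
      (mem_compSimple.mp hj).2 (hθ' l).1
  rw [comp_coxeterNumber hS₀ hθ', Finset.sum_congr rfl fun j hj => by
    rw [hn j hj, hηc j hj, Int.cast_one, one_mul], Finset.sum_const, nsmul_eq_mul] at hcox
  set K := (compSimple l).card
  have hθK : b.height (θ' l) = K := by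
    rw [comp_height_eq_sum hS₀ hθ' (hθ' l).1, Finset.sum_congr rfl hn]
    simp [K]
  have h1 := root'_eq_sum (root_weyl_eq_sum w (f := id) (comp_root_eq_sum hS₀ (hθ' l) hγ)) x
  rw [Finset.sum_congr rfl fun j hj => by
    rw [id, (hx l j (mem_extSimple.mpr (Or.inr hj))).2, hηc j hj]] at h1
  simp only [mul_sub, Finset.sum_sub_distrib, mul_left_comm _ ℏ, ← Finset.mul_sum,
    ← Finset.sum_mul] at h1
  have hht := comp_height_eq_sum hS₀ hθ' hγ
  have hht' : ∑ j ∈ compSimple l, (coord b γ j : ℂ) = b.height γ := by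
    rw [hht]
    push_cast
    rfl
  set B : ℤ := ∑ j ∈ compSimple l, coord b γ j * k j with hB
  have hB' : ∑ j ∈ compSimple l, (coord b γ j : ℂ) * k j = B := by
    rw [hB]
    push_cast
    rfl
  rw [hht', hB'] at h1
  rw [affRoot_apply, h1] at hN
  -- All `η` in the component agree, so `(K + 1) η = (r + 1) ℏ`, and `K + 1` times the value of the
  -- affine root is `ℏ Z`. A value in `2πiℤ` then forces `Z = 0`, because `ℏ ∉ πiℚ`.
  set Z : ℤ := b.height γ * (r l + 1) + (e - B) * (K + 1) with hZ
  have h2 : ℏ * Z = Real.pi * Complex.I * ((-2 * N * (K + 1) : ℤ) : ℂ) := by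
    rw [hZ]
    push_cast
    linear_combination -((K : ℂ) + 1) * hN - (b.height γ : ℂ) * hcox
  have hZ0 : Z = 0 := by
    by_contra hne
    refine hℏ ((-2 * N * (K + 1) : ℤ) / Z : ℚ) ?_
    have hZc : (Z : ℂ) ≠ 0 := by exact_mod_cast hne
    push_cast at h2 ⊢
    field_simp
    linear_combination h2
  have hdvd : ((K + 1 : ℕ) : ℤ) ∣ b.height γ * ((r l + 1 : ℕ) : ℤ) := by
    refine ⟨-(e - B), ?_⟩
    push_cast
    linarith
  have hcop : IsCoprime ((K + 1 : ℕ) : ℤ) ((r l + 1 : ℕ) : ℤ) := by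
    rw [Nat.isCoprime_iff_coprime, Nat.coprime_comm]
    exact hgcd
  -- Coprimality leaves `K + 1` dividing the height of `γ`, which is non-zero and at most `K` in
  -- absolute value.
  have h3 := hcop.dvd_of_dvd_mul_right hdvd
  have h4 := (hθ' l).height_le (compSimple_subset hS₀ l) hγ
  have h5 := (hθ' l).neg_height_le (compSimple_subset hS₀ l) (fun _ => neg_mem_compRoots) hγ
  refine b.height_ne_zero γ (Int.eq_zero_of_abs_lt_dvd h3 ?_)
  rw [abs_lt]
  push_cast
  omega

end NonIntegrality

/-! ### The invariance of the ideal -/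

section Main

variable [FiniteDimensional ℂ V] [P.IsCrystallographic]

lemma opT_eq_zero_of_generic {ℏ : ℂ} {i : ι} {k : ℤ} (t : ℂ) {f : periodicFunctions P} {x : V}
    (hexp : Complex.exp (-(affRoot P ℏ i k x)) ≠ 1) (hf : f.1 x = 0)
    (hf' : f.1 (affRefl P ℏ i k x) = 0) : (opT P ℏ i k t f).1 x = 0 := by
  rw [opT_apply P ℏ i k t f x hexp, hf, hf']
  ring

/-- The factor `t⁻¹ - t e^{-c}` is zero. The divided difference is defined everywhere, so no
condition on the denominator or on the reflected point is needed. -/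
lemma opT_eq_zero_of_value {ℏ : ℂ} {i : ι} {k : ℤ} {t c : ℂ} (ht : t ≠ 0)
    (htc : t ^ 2 = Complex.exp c) {f : periodicFunctions P} {x : V}
    (hx : affRoot P ℏ i k x = c) (hf : f.1 x = 0) : (opT P ℏ i k t f).1 x = 0 := by
  show t * f.1 x + (t⁻¹ - t * Complex.exp (-(affRoot P ℏ i k x))) *
    dividedDifference P ℏ i k f.1 x = 0
  rw [hf, hx, Complex.exp_neg, ← htc]
  field_simp
  ring

/-- If the operator `T` of `f` vanishes at the points near `x` on a line transversal to the zeros of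
the denominator, then it vanishes at `x`. -/
lemma opT_eq_zero_of_direction {ℏ : ℂ} {i : ι} {k : ℤ} (t : ℂ) {f : periodicFunctions P} {x v : V}
    (hv : P.root' i v = 1) (h : ∀ c : ℂ, Complex.exp (-(affRoot P ℏ i k (x + c • v))) ≠ 1 →
      (opT P ℏ i k t f).1 (x + c • v) = 0) : (opT P ℏ i k t f).1 x = 0 := by
  by_cases hexp : Complex.exp (-(affRoot P ℏ i k x)) = 1
  · have hcont : Continuous (opT P ℏ i k t f).1 := (opT P ℏ i k t f).2.1.continuous
    have hlim : Filter.Tendsto (fun n : ℕ => ((1 / ((n : ℝ) + 1) : ℝ) : ℂ)) Filter.atTop (nhds 0) := by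
      have h1 := (Complex.continuous_ofReal.tendsto 0).comp
        (tendsto_one_div_add_atTop_nhds_zero_nat (𝕜 := ℝ))
      rwa [Complex.ofReal_zero] at h1
    have hlim2 : Filter.Tendsto (fun n : ℕ => (opT P ℏ i k t f).1
        (x + ((1 / ((n : ℝ) + 1) : ℝ) : ℂ) • v)) Filter.atTop (nhds ((opT P ℏ i k t f).1 x)) := by
      refine (hcont.tendsto x).comp ?_
      have h2 := (hlim.smul_const v).const_add x
      simpa using h2
    refine tendsto_nhds_unique hlim2 (tendsto_const_nhds.congr fun n => ?_)
    refine (h _ fun hn => ?_).symm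
    -- The affine root moves by a positive real number from a value in `2πiℤ`, so its exponential
    -- leaves one.
    have h3 : affRoot P ℏ i k (x + ((1 / ((n : ℝ) + 1) : ℝ) : ℂ) • v) =
        affRoot P ℏ i k x + ((1 / ((n : ℝ) + 1) : ℝ) : ℂ) := by
      rw [affRoot_apply, affRoot_apply, map_add, map_smul, hv, smul_eq_mul, mul_one]
      ring
    rw [h3, neg_add, Complex.exp_add, hexp, one_mul, ← Complex.ofReal_neg, ← Complex.ofReal_exp,
      Complex.ofReal_eq_one, Real.exp_eq_one_iff] at hn
    have : (0 : ℝ) < 1 / ((n : ℝ) + 1) := by positivity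
    linarith
  · have := h 0
    simp only [zero_smul, add_zero] at this
    exact this hexp

variable [Finite ι] [P.IsRootSystem] [P.IsReduced]
  {b : P.Base} {ℏ : ℂ} {θ : ι} {η : ι → ℂ} {S₀ : Finset ι} {θ' : Component P S₀ → ι}
  {r : Component P S₀ → ℕ}

lemma opT_vanishes (hℏ : ∀ q : ℚ, ℏ ≠ Real.pi * Complex.I * q)
    (hθ : IsMaximalRoot P (b.support : Set ι) Set.univ θ)
    (hη : ∀ (w : P.weylGroup) (i : ι), η (P.weylGroupToPerm w i) = η i)
    (hS₀ : S₀ ⊆ b.support)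
    (hθ' : ∀ l, IsMaximalRoot P (compSimple l : Set ι) (compRoots l) (θ' l))
    (hA : ∀ l, IsTypeA P (compRoots l) (compSimple l).card →
      Nat.gcd (r l + 1) ((compSimple l).card + 1) = 1)
    (hnotA : ∀ l, ¬ IsTypeA P (compRoots l) (compSimple l).card → r l = 0)
    (hcox : ∀ l, coxeterNumber b η (θ' l) = (r l + 1) * ℏ)
    (j : Node b) {t : ℂ} (ht₀ : t ≠ 0) (ht : t ^ 2 = Complex.exp (η (nodeRoot b θ j)))
    {f : periodicFunctions P} (hf : ∀ x ∈ extArrangement b ℏ θ η θ', f.1 x = 0) {x : V}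
    (hx : x ∈ extArrangement b ℏ θ η θ') :
    (opT P ℏ (nodeRoot b θ j) (nodeLevel b j) t f).1 x = 0 := by
  have hℏ0 : ℏ ≠ 0 := by simpa using hℏ 0
  obtain ⟨w, k, hk⟩ := mem_extArrangement.mp hx
  by_cases hnode : ∃ l, ∃ α ∈ extSimple θ' l,
      P.weylGroupToPerm w α = nodeRoot b θ j ∧ k α = nodeLevel b j
  · obtain ⟨l, α, hα, h1, h2⟩ := hnode
    refine opT_eq_zero_of_value ht₀ ht ?_ (hf x hx)
    rw [affRoot_apply, ← h1, ← h2, (hk l α hα).2, hη]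
    ring
  -- Stated for all points with the same `w` and `k`, not only for `x`, because the last case needs
  -- it along a line in the plane.
  have hgen : ∀ y, HasLevels b ℏ θ η θ' w k y →
      Complex.exp (-(affRoot P ℏ (nodeRoot b θ j) (nodeLevel b j) y)) ≠ 1 →
      (opT P ℏ (nodeRoot b θ j) (nodeLevel b j) t f).1 y = 0 := fun y hy hexp =>
    opT_eq_zero_of_generic t hexp (hf y (mem_extArrangement.mpr ⟨w, k, hy⟩))
      (hf _ (hy.affRefl_mem hθ j fun l α hα h => hnode ⟨l, α, hα, h⟩))
  obtain ⟨γ, hγ⟩ := (P.weylGroupToPerm w).surjective (nodeRoot b θ j)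
  by_cases hsub : γ ∈ subRoots P S₀
  · obtain ⟨l, hl⟩ := exists_mem_compRoots hsub
    refine hgen x hk ?_
    rw [← hγ]
    by_cases hAl : IsTypeA P (compRoots l) (compSimple l).card
    · exact hk.exp_ne_one_of_isTypeA hS₀ hθ' hη hℏ (hcox l) hAl (hA l hAl) hl _
    · obtain ⟨α, hα, h⟩ := hk.exists_eq_node hS₀ hθ' hη hℏ0 (hcox l) (hnotA l hAl) hl hγ
      exact absurd ⟨l, α, hα, h⟩ hnode
  · obtain ⟨v, hv, hdir⟩ := HasLevels.exists_direction (b := b) (ℏ := ℏ) (θ := θ) (η := η)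
      hθ' w hsub
    rw [hγ] at hv
    exact opT_eq_zero_of_direction t hv fun c => hgen _ (hdir k x hk c)

end Main

end DahaIdeals

theorem mainTheorem2 {ι : Type*} [Finite ι] {M : Type*} [AddCommGroup M] [Module ℂ M]
    {V : Type*} [NormedAddCommGroup V] [NormedSpace ℂ V] [FiniteDimensional ℂ V]
    (P : RootPairing ι ℂ M V) [P.IsRootSystem] [P.IsCrystallographic] [P.IsReduced]
    [P.IsIrreducible] (b : P.Base)
    -- the parameter `ℏ ∉ πi ℚ`
    (ℏ : ℂ) (hℏ : ∀ q : ℚ, ℏ ≠ Real.pi * Complex.I * q)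
    -- the integer `ε₀` with `(P, P^∨) ⊆ ε₀⁻¹ ℤ`
    (ε₀ : ℤ) (hε₀ : ε₀ ≠ 0)
    (hε₀' : ∀ μ : V →ₗ[ℂ] ℂ, DahaIdeals.IsWeight P μ → ∀ v ∈ DahaIdeals.coweightLattice P,
      ∃ k : ℤ, ε₀ * μ v = k)
    -- the maximal root of `R`
    (θ : ι) (hθ : DahaIdeals.IsMaximalRoot P (b.support : Set ι) Set.univ θ)
    -- the non-zero function `t` on affine roots, invariant under the extended affine Weyl group
    (t : ι → ℤ → ℂ) (ht₀ : ∀ i k, t i k ≠ 0)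
    (ht_inv : ∀ g ∈ DahaIdeals.extAffWeyl P ℏ, ∀ i k j l,
      DahaIdeals.actFunctional g (DahaIdeals.affRoot P ℏ i k) = DahaIdeals.affRoot P ℏ j l →
        t j l = t i k)
    -- the `W`-invariant function `η` on roots
    (η : ι → ℂ) (hη : ∀ (w : P.weylGroup) (i : ι), η (P.weylGroupToPerm w i) = η i)
    -- the set `S₀` of simple roots and the numbers `r_ℓ`
    (S₀ : Finset ι) (hS₀ : S₀ ⊆ b.support) (r : DahaIdeals.Component P S₀ → ℕ)
    (hr : ∀ l l', DahaIdeals.RootsIso P (DahaIdeals.compRoots l) (DahaIdeals.compRoots l') →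
      r l = r l')
    -- the maximal roots of the components
    (θ' : DahaIdeals.Component P S₀ → ι)
    (hθ' : ∀ l, DahaIdeals.IsMaximalRoot P (DahaIdeals.compSimple l : Set ι)
      (DahaIdeals.compRoots l) (θ' l))
    -- the conditions on the parameters
    (hA : ∀ l, DahaIdeals.IsTypeA P (DahaIdeals.compRoots l) (DahaIdeals.compSimple l).card →
      Nat.gcd (r l + 1) ((DahaIdeals.compSimple l).card + 1) = 1)
    (hnotA : ∀ l, ¬ DahaIdeals.IsTypeA P (DahaIdeals.compRoots l) (DahaIdeals.compSimple l).card →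
      r l = 0)
    (hcox : ∀ l, DahaIdeals.coxeterNumber b η (θ' l) = (r l + 1) * ℏ)
    (ht : ∀ i, t i 0 ^ 2 = Complex.exp (η i)) :
    (∀ a ∈ DahaIdeals.dahaOperators b ℏ ε₀ θ t,
      ∀ f ∈ DahaIdeals.vanishingIdeal P (DahaIdeals.arrangement b ℏ η r),
        a f ∈ DahaIdeals.vanishingIdeal P (DahaIdeals.arrangement b ℏ η r)) ∧
    (∀ ρ : DahaIdeals.Daha b ℏ ε₀ θ t →ₐ[ℂ] Module.End ℂ (DahaIdeals.periodicFunctions P),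
      DahaIdeals.IsPolynomialRepresentation b ℏ ε₀ θ t ρ →
      ∀ a, ∀ f ∈ DahaIdeals.vanishingIdeal P (DahaIdeals.arrangement b ℏ η r),
        ρ a f ∈ DahaIdeals.vanishingIdeal P (DahaIdeals.arrangement b ℏ η r)) := by
  have hℏ0 : ℏ ≠ 0 := by simpa using hℏ 0
  have hr' : ∀ l, r l = 0 ∨ ∀ j ∈ DahaIdeals.compSimple l, DahaIdeals.coord b (θ' l) j = 1 := by
    intro l
    by_cases h : DahaIdeals.IsTypeA P (DahaIdeals.compRoots l) (DahaIdeals.compSimple l).card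
    · exact Or.inr fun j hj => h.coord_maximal hS₀ (hθ' l) hj
    · exact Or.inl (hnotA l h)
  have hD : DahaIdeals.arrangement b ℏ η r = DahaIdeals.extArrangement b ℏ θ η θ' :=
    DahaIdeals.arrangement_eq_extArrangement hS₀ hθ' hη hθ hr' hcox hℏ0
  rw [hD]
  have main : ∀ a ∈ DahaIdeals.dahaOperators b ℏ ε₀ θ t,
      ∀ f ∈ DahaIdeals.vanishingIdeal P (DahaIdeals.extArrangement b ℏ θ η θ'),
        a f ∈ DahaIdeals.vanishingIdeal P (DahaIdeals.extArrangement b ℏ θ η θ') := by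
    intro a ha
    induction ha using Algebra.adjoin_induction with
    | mem a ha =>
      obtain ⟨x, rfl⟩ := ha
      intro f hf
      cases x with
      | T j =>
        refine fun x hx => DahaIdeals.opT_vanishes hℏ hθ hη hS₀ hθ' hA hnotA hcox j (ht₀ _ _) ?_ hf hx
        cases j with
        | none =>
          have h := DahaIdeals.parameter_succ b ht_inv (P.reflectionPerm θ θ) 0
          rw [zero_add] at h
          show t (P.reflectionPerm θ θ) 1 ^ 2 = _
          rw [h, ht]
          rfl
        | some i => exact ht i
      | X μ => exact Ideal.mul_mem_left _ _ hf
      | pi g =>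
        exact fun x hx =>
          hf _ (DahaIdeals.extArrangement_groupPi hℏ0 hθ (inv_mem g.2) hx)
    | algebraMap c =>
      intro f hf
      rw [Module.algebraMap_end_apply, Algebra.smul_def]
      exact Ideal.mul_mem_left _ _ hf
    | add a c _ _ iha ihc => exact fun f hf => Ideal.add_mem _ (iha f hf) (ihc f hf)
    | mul a c _ _ iha ihc => exact fun f hf => iha _ (ihc f hf)
  -- The image of any such `ρ` lies in the algebra generated by the operators, by induction on a
  -- lift to the free algebra.
  refine ⟨main, fun ρ hρ a => main _ ?_⟩
  obtain ⟨a, rfl⟩ := RingQuot.mkAlgHom_surjective ℂ _ a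
  induction a using FreeAlgebra.induction with
  | grade0 c =>
    rw [AlgHom.commutes, AlgHom.commutes]
    exact Subalgebra.algebraMap_mem _ c
  | grade1 x =>
    have h := hρ x
    rw [DahaIdeals.Daha.gen] at h
    rw [h]
    exact Algebra.subset_adjoin ⟨x, rfl⟩
  | mul a c iha ihc =>
    rw [map_mul, map_mul]
    exact mul_mem iha ihc
  | add a c iha ihc =>
    rw [map_add, map_add]
    exact add_mem iha ihc
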